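/- Let $n\ge 1$. Regard real $n\times n$ matrices as vectors of $\mathbb{R}^{n^2}$ with the Euclidean norm. For a permutation $\sigma$ of $\{1,\dots,n\}$ let $P_\sigma$ be its permutation matrix, and let $\mathbb{1}$ be the all-ones matrix. Let $V_n\subset\mathbb{R}^{n^2}$ be the subspace of matrices orthogonal to each of the $2n$ matrices that have ones in a single row or in a single column and zeros elsewhere, and let $S_n$ be the sphere of radius $\sqrt{n-1}$ about the origin in $\mathbb{R}^{(n-1)^2}$. For an orthonormal basis $Q=(q_1,\dots,q_{(n-1)^2})$ of $V_n$ define $$\Phi_Q(\sigma)=\text{the coordinates in the basis } Q \text{ of the orthogonal projection of } P_\sigma-\tfrac1n\mathbb{1} \text{ to } V_n,\qquad T_Q(y)=\tfrac1n\mathbb{1}+\sum_k y_kq_k .$$ The model of computation is the real RAM: exact real arithmetic $+,-,\times,/,\sqrt{\ }$ and comparisons, integer addition, subtraction and comparisons, and array access by integer indices, each at unit cost, with no real constants other than those obtained from integers. There are three programs PRE, FWD, BWD, independent of $n$, and a constant $C$ such that for every $n\ge1$ the following holds. 1. (Basis, computed once for each $n$.) There is an orthonormal basis $Q$ of $V_n$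 with $(n-1)^2$ elements that PRE computes from $n$ in at most $Cn^6$ operations. PRE followed by FWD, and PRE followed by BWD, perform with this $Q$ the tasks of FWD and BWD described in items 2 and 3, from the input $n$ and $P_\sigma$, or $n$ and $y$, alone, in at most $Cn^6$ operations in total. Thus both transformations take polynomial time. 2. (Permutations to the sphere.) For every orthonormal basis $Q$ of $V_n$ with $(n-1)^2$ elements and every permutation $\sigma$, the point $\Phi_Q(\sigma)$ lies on $S_n$, $T_Q(\Phi_Q(\sigma))=P_\sigma$, and FWD computes $\Phi_Q(\sigma)$ from $n$, $Q$ and $P_\sigma$ in at most $Cn^4$ operations. 3. (Sphere to permutations.) For every such $Q$ and every point $y\in S_n$, BWD computes from $n$, $Q$ and $y$, in at most $Cn^4$ operations, a permutation matrix $P_\sigma$ that is closest to $T_Q(y)$ in the Euclidean norm among all $n\times n$ permutation matrices. 4. (Nearest permutation as a bipartite matching.) For every real $n\times n$ matrix $T$, the permutation matrix $P_\sigma$ is a closest one to $T$ if and only if the perfect matching $\{(i,\sigma(i))\}$ of the complete bipartite graph on $n+n$ vertices has minimum weight for the edge weights $w_{ij}=(T_{ij}-1)^2-T_{ij}^2$.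 -/

import Mathlib

/-! ## Real random access machine

A program is a structured program over two kinds of memory: arrays of natural numbers and
arrays of real numbers.  Every literal, array access, arithmetic operation, comparison,
assignment and branching costs one unit.  The integer arithmetic is that of the usual
random access machine (addition and truncated subtraction), the real arithmetic consists of
the field operations and the square root, and the only real constants are those that come
from integers.  A program has finite size and does not depend on the size of the input. -/

namespace RealRAM

/-- The memory: `int a i` and `real a i` are the `i`-th cells of the arrays with name `a`. -/
@[ext]
structure Mem where
  int : ℕ → ℕ → ℕ
  real : ℕ → ℕ → ℝ

/-- Integer expressions. -/
inductive IExpr where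
  | lit (c : ℕ)
  | get (a : ℕ) (i : IExpr)
  | add (e f : IExpr)
  | sub (e f : IExpr)

namespace IExpr

/-- Value of an integer expression. -/
def eval (s : Mem) : IExpr → ℕ
  | lit c => c
  | get a i => s.int a (i.eval s)
  | add e f => e.eval s + f.eval s
  | sub e f => e.eval s - f.eval s

/-- Number of unit operations for the evaluation of an integer expression. -/
def cost : IExpr → ℕ
  | lit _ => 1
  | get _ i => i.cost + 1
  | add e f => e.cost + f.cost + 1
  | sub e f => e.cost + f.cost + 1

end IExpr

/-- Real expressions. -/
inductive RExpr where
  | ofInt (e : IExpr)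
  | get (a : ℕ) (i : IExpr)
  | add (e f : RExpr)
  | sub (e f : RExpr)
  | mul (e f : RExpr)
  | div (e f : RExpr)
  | sqrt (e : RExpr)

namespace RExpr

/-- Value of a real expression (a division by `0` and the square root of a negative number
return `0`). -/
noncomputable def eval (s : Mem) : RExpr → ℝ
  | ofInt e => (e.eval s : ℝ)
  | get a i => s.real a (i.eval s)
  | add e f => e.eval s + f.eval s
  | sub e f => e.eval s - f.eval s
  | mul e f => e.eval s * f.eval s
  | div e f => e.eval s / f.eval s
  | sqrt e => Real.sqrt (e.eval s)

/-- Number of unit operations for the evaluation of a real expression. -/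
def cost : RExpr → ℕ
  | ofInt e => e.cost + 1
  | get _ i => i.cost + 1
  | add e f => e.cost + f.cost + 1
  | sub e f => e.cost + f.cost + 1
  | mul e f => e.cost + f.cost + 1
  | div e f => e.cost + f.cost + 1
  | sqrt e => e.cost + 1

end RExpr

/-- Tests: comparisons of integers and of reals, and their Boolean combinations. -/
inductive Test where
  | leInt (e f : IExpr)
  | leReal (e f : RExpr)
  | neg (b : Test)
  | and (b c : Test)

namespace Test

/-- Truth of a test. -/
def Holds (s : Mem) : Test → Prop
  | leInt e f => e.eval s ≤ f.eval s
  | leReal e f => e.eval s ≤ f.eval s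
  | neg b => ¬ b.Holds s
  | and b c => b.Holds s ∧ c.Holds s

/-- Number of unit operations for a test. -/
def cost : Test → ℕ
  | leInt e f => e.cost + f.cost + 1
  | leReal e f => e.cost + f.cost + 1
  | neg b => b.cost + 1
  | and b c => b.cost + c.cost + 1

end Test

/-- Programs. `setInt a i e` is the assignment `a[i] := e`; `loop b p` repeats `p` as
long as the test `b` holds. -/
inductive Prog where
  | skip
  | setInt (a : ℕ) (i e : IExpr)
  | setReal (a : ℕ) (i : IExpr) (e : RExpr)
  | seq (p q : Prog)
  | ite (b : Test) (p q : Prog)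
  | loop (b : Test) (p : Prog)

/-- Overwrite one integer cell. -/
def Mem.putInt (s : Mem) (a i v : ℕ) : Mem :=
  { s with int := Function.update s.int a (Function.update (s.int a) i v) }

/-- Overwrite one real cell. -/
noncomputable def Mem.putReal (s : Mem) (a i : ℕ) (v : ℝ) : Mem :=
  { s with real := Function.update s.real a (Function.update (s.real a) i v) }

/-- `Exec p s t s'`: the program `p`, started in the memory `s`, halts after `t` unit
operations with the memory `s'`. -/
inductive Exec : Prog → Mem → ℕ → Mem → Prop where
  | skip (s : Mem) : Exec .skip s 1 s
  | setInt (s : Mem) (a : ℕ) (i e : IExpr) :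
      Exec (.setInt a i e) s (i.cost + e.cost + 1) (s.putInt a (i.eval s) (e.eval s))
  | setReal (s : Mem) (a : ℕ) (i : IExpr) (e : RExpr) :
      Exec (.setReal a i e) s (i.cost + e.cost + 1) (s.putReal a (i.eval s) (e.eval s))
  | seq {p q : Prog} {s s₁ s₂ : Mem} {t₁ t₂ : ℕ} :
      Exec p s t₁ s₁ → Exec q s₁ t₂ s₂ → Exec (.seq p q) s (t₁ + t₂) s₂
  | iteTrue {b : Test} {p q : Prog} {s s' : Mem} {t : ℕ} :
      b.Holds s → Exec p s t s' → Exec (.ite b p q) s (b.cost + 1 + t) s'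
  | iteFalse {b : Test} {p q : Prog} {s s' : Mem} {t : ℕ} :
      ¬ b.Holds s → Exec q s t s' → Exec (.ite b p q) s (b.cost + 1 + t) s'
  | loopTrue {b : Test} {p : Prog} {s s₁ s₂ : Mem} {t₁ t₂ : ℕ} :
      b.Holds s → Exec p s t₁ s₁ → Exec (.loop b p) s₁ t₂ s₂ →
        Exec (.loop b p) s (b.cost + 1 + t₁ + t₂) s₂
  | loopFalse {b : Test} {p : Prog} {s : Mem} :
      ¬ b.Holds s → Exec (.loop b p) s (b.cost + 1) s

/-- The program `p`, started in `s`, halts after at most `T` unit operations in a memory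
with the property `post`. -/
def HaltsWithin (p : Prog) (s : Mem) (T : ℕ) (post : Mem → Prop) : Prop :=
  ∃ t s', Exec p s t s' ∧ t ≤ T ∧ post s'

/-- A finite list of reals as the contents of a real array, padded with zeros. -/
noncomputable def pad {k : ℕ} (v : Fin k → ℝ) : ℕ → ℝ :=
  fun i => if h : i < k then v ⟨i, h⟩ else 0

/-- The memory with the number `n` in cell `0` of integer array `0`, the contents `q` of real
array `0`, the contents `x` of real array `1`, and zeros everywhere else. -/
noncomputable def load (n : ℕ) (q x : ℕ → ℝ) : Mem where
  int := fun a i => if a = 0 ∧ i = 0 then n else 0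
  real := fun a => if a = 0 then q else if a = 1 then x else 0

/-- Real array `2`, the output array, begins with the list `v`. -/
def Outputs {k : ℕ} (v : Fin k → ℝ) (s : Mem) : Prop :=
  ∀ i : Fin k, s.real 2 i = v i

end RealRAM

/-! ## Permutation matrices and the sphere -/

namespace PermSphere

open RealRAM

/-- Real `n × n` matrices as vectors of the Euclidean space of dimension `n ^ 2`. -/
abbrev MatVec (n : ℕ) : Type := EuclideanSpace ℝ (Fin n × Fin n)

/-- The Euclidean space that contains the sphere. -/
abbrev Point (n : ℕ) : Type := EuclideanSpace ℝ (Fin ((n - 1) ^ 2))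

/-- The permutation matrix of `σ`, with entry `1` at `(i, j)` if `σ i = j` and `0`
otherwise, as a vector. -/
noncomputable def permVec {n : ℕ} (σ : Equiv.Perm (Fin n)) : MatVec n :=
  WithLp.toLp 2 fun p => σ.permMatrix ℝ p.1 p.2

/-- The matrix all of whose entries are `1 / n`. -/
noncomputable def center (n : ℕ) : MatVec n :=
  WithLp.toLp 2 fun _ => 1 / (n : ℝ)

/-- The matrix with ones in row `i` and zeros elsewhere. -/
noncomputable def rowOnes {n : ℕ} (i : Fin n) : MatVec n :=
  WithLp.toLp 2 fun p => if p.1 = i then 1 else 0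

/-- The matrix with ones in column `j` and zeros elsewhere. -/
noncomputable def colOnes {n : ℕ} (j : Fin n) : MatVec n :=
  WithLp.toLp 2 fun p => if p.2 = j then 1 else 0

/-- The subspace orthogonal to all the matrices `rowOnes i` and `colOnes j`. -/
noncomputable def sumZero (n : ℕ) : Submodule ℝ (MatVec n) :=
  (Submodule.span ℝ (Set.range (rowOnes (n := n)) ∪ Set.range (colOnes (n := n))))ᗮ

/-- Orthonormal bases of that subspace with `(n - 1) ^ 2` elements. -/
abbrev Basis (n : ℕ) : Type :=
  OrthonormalBasis (Fin ((n - 1) ^ 2)) ℝ (sumZero n)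

/-- The sphere of radius `√(n - 1)` about the origin. -/
noncomputable def sphere (n : ℕ) : Set (Point n) :=
  Metric.sphere 0 (Real.sqrt ((n : ℝ) - 1))

/-- From permutations to points: shift the permutation matrix, project it orthogonally to
the subspace, and take coordinates in the basis `Q`. -/
noncomputable def toPoint {n : ℕ} (Q : Basis n) (σ : Equiv.Perm (Fin n)) : Point n :=
  Q.repr ((sumZero n).orthogonalProjectionOnto (permVec σ - center n))

/-- From points to matrices: the reversed linear change of coordinates and shift. -/
noncomputable def toMat {n : ℕ} (Q : Basis n) (y : Point n) : MatVec n :=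
  (Q.repr.symm y : MatVec n) + center n

/-- The permutation matrix of `σ` is one of those closest to `T`. -/
def IsNearest {n : ℕ} (T : MatVec n) (σ : Equiv.Perm (Fin n)) : Prop :=
  ∀ τ : Equiv.Perm (Fin n), ‖T - permVec σ‖ ≤ ‖T - permVec τ‖

/-- The perfect matching that pairs the left vertex `i` with the right vertex `σ i` of the
complete bipartite graph on `n + n` vertices has the least weight among all perfect matchings,
where `w i j` is the weight of the edge from `i` to `j`. -/
def IsMinWeightMatching {n : ℕ} (w : Matrix (Fin n) (Fin n) ℝ) (σ : Equiv.Perm (Fin n)) :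
    Prop :=
  ∀ τ : Equiv.Perm (Fin n), ∑ i, w i (σ i) ≤ ∑ i, w i (τ i)

/-- The edge weights of the matching problem: the change of the squared distance to `T` if
the entry `0` at `(i, j)` is replaced by `1`. -/
noncomputable def weight {n : ℕ} (T : MatVec n) : Matrix (Fin n) (Fin n) ℝ :=
  fun i j => (T (i, j) - 1) ^ 2 - T (i, j) ^ 2

/-- The entries of a matrix, row by row. -/
noncomputable def rowMajor {n : ℕ} (A : MatVec n) : Fin (n * n) → ℝ :=
  fun k => A (finProdFinEquiv.symm k)

/-- The entries of a basis, one basis vector after the other, each of them row by row. -/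
noncomputable def basisEntries {n : ℕ} (Q : Basis n) : Fin ((n - 1) ^ 2 * (n * n)) → ℝ :=
  fun k => rowMajor (Q (finProdFinEquiv.symm k).1 : MatVec n) (finProdFinEquiv.symm k).2

/-- Started with `q` in real array `0` and a permutation matrix in the input array, `p`
outputs within `T` operations the point that corresponds to the permutation. -/
def ComputesPoint {n : ℕ} (p : Prog) (q : ℕ → ℝ) (Q : Basis n) (T : ℕ) : Prop :=
  ∀ σ : Equiv.Perm (Fin n),
    HaltsWithin p (load n q (pad (rowMajor (permVec σ)))) T (Outputs (toPoint Q σ))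

/-- Started with `q` in real array `0` and a point of the sphere in the input array, `p`
outputs within `T` operations a permutation matrix closest to the matrix that corresponds to
the point. -/
def ComputesPerm {n : ℕ} (p : Prog) (q : ℕ → ℝ) (Q : Basis n) (T : ℕ) : Prop :=
  ∀ y ∈ sphere n, ∃ σ : Equiv.Perm (Fin n), IsNearest (toMat Q y) σ ∧
    HaltsWithin p (load n q (pad y)) T (Outputs (rowMajor (permVec σ)))

end PermSphere

/-! Geometry. The rows and columns of P_σ − 𝟙/n sum to zero, so this matrix already lies in V_n: the
projection does nothing, the coordinates recover P_σ, and the squared norm is n − 1. As 𝟙 is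
orthogonal to V_n, the coordinates are plain inner products of q_k with P_σ (`toPoint_apply`), so
FWD needs (n−1)²·n² multiply-and-add steps. Expanding the square entry by entry gives ‖T − P_σ‖² =
‖T‖² + the weight of the matching σ (`norm_sub_permVec_sq`), which is item 4.

Basis. PRE writes down tensor products of Helmert vectors. Their entries need only integers, a
division and a square root. Orthonormality is a direct computation, and completeness holds because
nothing nonzero in V_n is orthogonal to all of them (`eq_zero_of_inner_helmertMat`).

Nearest permutation. Since w_ij = 1 − 2T_ij, one may minimise any cost of the form a − T_ij. The
choice a = n + 1/n makes all costs nonnegative on S_n, so zero potentials are feasible and the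
Hungarian algorithm can start. It inserts the rows one at a time. For each row an alternating tree
of tight edges gains at most n columns, each found by scanning all pairs, which gives n·n·n² = n⁴.
The invariants are `Matched`, `Tree` and `Augmenting`; at the end, linear programming duality
(`Matched.exists_perm`) gives optimality.

Programs. A small program logic carries invariants and time bounds together (`HaltsWithin.loop`,
`HaltsWithin.for`), and `Exec.frame` shows that arrays a program never assigns are unchanged. PRE
restores its scratch variables, so its final memory is exactly the initial memory of FWD or BWD with
the basis loaded, and composition is immediate. -/

namespace RealRAM

/-! ### Program logic with running times -/

/-- The program `p`, started in `s`, halts; its running time and final memory satisfy `R`. -/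
def Wp (p : Prog) (s : Mem) (R : ℕ → Mem → Prop) : Prop :=
  ∃ t s', Exec p s t s' ∧ R t s'

theorem haltsWithin_iff_wp {p : Prog} {s : Mem} {T : ℕ} {post : Mem → Prop} :
    HaltsWithin p s T post ↔ Wp p s fun t s' => t ≤ T ∧ post s' := Iff.rfl

theorem HaltsWithin.mono {p : Prog} {s : Mem} {T T' : ℕ} {post post' : Mem → Prop}
    (h : HaltsWithin p s T post) (hT : T ≤ T') (hpost : ∀ s', post s' → post' s') :
    HaltsWithin p s T' post' := by
  obtain ⟨t, s', he, ht, hp⟩ := h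
  exact ⟨t, s', he, ht.trans hT, hpost _ hp⟩

theorem HaltsWithin.seq {p q : Prog} {s : Mem} {T₁ T₂ : ℕ} {mid post : Mem → Prop}
    (h₁ : HaltsWithin p s T₁ mid) (h₂ : ∀ s', mid s' → HaltsWithin q s' T₂ post) :
    HaltsWithin (p.seq q) s (T₁ + T₂) post := by
  obtain ⟨t, s', he, ht, hp⟩ := h₁
  obtain ⟨t', s'', he', ht', hp'⟩ := h₂ s' hp
  exact ⟨t + t', s'', he.seq he', by omega, hp'⟩

theorem wp_skip {s : Mem} {R : ℕ → Mem → Prop} : Wp .skip s R ↔ R 1 s := by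
  constructor
  · rintro ⟨t, s', h, hR⟩
    cases h
    exact hR
  · exact fun h => ⟨_, _, .skip s, h⟩

theorem wp_setInt {s : Mem} {a : ℕ} {i e : IExpr} {R : ℕ → Mem → Prop} :
    Wp (.setInt a i e) s R ↔ R (i.cost + e.cost + 1) (s.putInt a (i.eval s) (e.eval s)) := by
  constructor
  · rintro ⟨t, s', h, hR⟩
    cases h
    exact hR
  · exact fun h => ⟨_, _, .setInt s a i e, h⟩

theorem wp_setReal {s : Mem} {a : ℕ} {i : IExpr} {e : RExpr} {R : ℕ → Mem → Prop} :
    Wp (.setReal a i e) s R ↔ R (i.cost + e.cost + 1) (s.putReal a (i.eval s) (e.eval s)) := by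
  constructor
  · rintro ⟨t, s', h, hR⟩
    cases h
    exact hR
  · exact fun h => ⟨_, _, .setReal s a i e, h⟩

theorem wp_seq {p q : Prog} {s : Mem} {R : ℕ → Mem → Prop} :
    Wp (.seq p q) s R ↔ Wp p s fun t₁ s₁ => Wp q s₁ fun t₂ s₂ => R (t₁ + t₂) s₂ := by
  constructor
  · rintro ⟨t, s', h, hR⟩
    cases h with
    | seq h₁ h₂ => exact ⟨_, _, h₁, _, _, h₂, hR⟩
  · rintro ⟨t, s', h, t', s'', h', hR⟩
    exact ⟨_, _, h.seq h', hR⟩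

theorem wp_ite {b : Test} {p q : Prog} {s : Mem} {R : ℕ → Mem → Prop} :
    Wp (.ite b p q) s R ↔
      (b.Holds s → Wp p s fun t s' => R (b.cost + 1 + t) s') ∧
      (¬ b.Holds s → Wp q s fun t s' => R (b.cost + 1 + t) s') := by
  constructor
  · rintro ⟨t, s', h, hR⟩
    cases h with
    | iteTrue hb h => exact ⟨fun _ => ⟨_, _, h, hR⟩, fun hn => absurd hb hn⟩
    | iteFalse hb h => exact ⟨fun hn => absurd hn hb, fun _ => ⟨_, _, h, hR⟩⟩
  · rintro ⟨h₁, h₂⟩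
    by_cases hb : b.Holds s
    · obtain ⟨t, s', h, hR⟩ := h₁ hb
      exact ⟨_, _, .iteTrue hb h, hR⟩
    · obtain ⟨t, s', h, hR⟩ := h₂ hb
      exact ⟨_, _, .iteFalse hb h, hR⟩

@[simp] theorem Mem.putInt_real (s : Mem) (a i v : ℕ) : (s.putInt a i v).real = s.real := rfl

@[simp] theorem Mem.putReal_int (s : Mem) (a i : ℕ) (v : ℝ) : (s.putReal a i v).int = s.int := rfl

@[simp] theorem Mem.putInt_int_self (s : Mem) (a i v : ℕ) :
    (s.putInt a i v).int a = Function.update (s.int a) i v := by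
  simp [Mem.putInt]

@[simp] theorem Mem.putReal_real_self (s : Mem) (a i : ℕ) (v : ℝ) :
    (s.putReal a i v).real a = Function.update (s.real a) i v := by
  simp [Mem.putReal]

@[simp] theorem Mem.putInt_int_of_ne (s : Mem) {a b : ℕ} (i v : ℕ) (h : b ≠ a) :
    (s.putInt a i v).int b = s.int b := by
  simp [Mem.putInt, h]

@[simp] theorem Mem.putReal_real_of_ne (s : Mem) {a b : ℕ} (i : ℕ) (v : ℝ) (h : b ≠ a) :
    (s.putReal a i v).real b = s.real b := by
  simp [Mem.putReal, h]

namespace Prog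

/-- The program contains an assignment to the integer array `a`. -/
def writesInt : Prog → ℕ → Bool
  | skip, _ => false
  | setInt b _ _, a => b == a
  | setReal _ _ _, _ => false
  | seq p q, a => p.writesInt a || q.writesInt a
  | ite _ p q, a => p.writesInt a || q.writesInt a
  | loop _ p, a => p.writesInt a

/-- The program contains an assignment to the real array `a`. -/
def writesReal : Prog → ℕ → Bool
  | skip, _ => false
  | setInt _ _ _, _ => false
  | setReal b _ _, a => b == a
  | seq p q, a => p.writesReal a || q.writesReal a
  | ite _ p q, a => p.writesReal a || q.writesReal a
  | loop _ p, a => p.writesReal a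

/-- All integer assignments of the program are to cells with index `0`. -/
def scalarInt : Prog → Bool
  | skip => true
  | setInt _ (.lit 0) _ => true
  | setInt _ _ _ => false
  | setReal _ _ _ => true
  | seq p q => p.scalarInt && q.scalarInt
  | ite _ p q => p.scalarInt && q.scalarInt
  | loop _ p => p.scalarInt

end Prog

/-- The memories `s` and `s'` agree on all arrays to which `p` does not write. -/
structure Frame (p : Prog) (s s' : Mem) : Prop where
  int : ∀ a, p.writesInt a = false → s'.int a = s.int a
  real : ∀ a, p.writesReal a = false → s'.real a = s.real a
  scalar : p.scalarInt = true → ∀ a i, s'.int a (i + 1) = s.int a (i + 1)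

theorem Frame.refl (p : Prog) (s : Mem) : Frame p s s :=
  ⟨fun _ _ => rfl, fun _ _ => rfl, fun _ _ _ => rfl⟩

theorem Frame.trans {p : Prog} {s₁ s₂ s₃ : Mem} (h : Frame p s₁ s₂) (h' : Frame p s₂ s₃) :
    Frame p s₁ s₃ :=
  ⟨fun a ha => (h'.int a ha).trans (h.int a ha), fun a ha => (h'.real a ha).trans (h.real a ha),
    fun hp a i => (h'.scalar hp a i).trans (h.scalar hp a i)⟩

theorem Frame.mono {p q : Prog} {s s' : Mem} (h : Frame p s s')
    (hi : ∀ a, q.writesInt a = false → p.writesInt a = false)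
    (hr : ∀ a, q.writesReal a = false → p.writesReal a = false)
    (hs : q.scalarInt = true → p.scalarInt = true) : Frame q s s' :=
  ⟨fun a ha => h.int a (hi a ha), fun a ha => h.real a (hr a ha),
    fun hq a i => h.scalar (hs hq) a i⟩

/-- The write sets are syntactic, so for a concrete program every "this array is untouched"
obligation is settled by `decide`. The `scalar` part records that cells of positive index survive
when only integer variables are assigned. -/
theorem Exec.frame {p : Prog} {s s' : Mem} {t : ℕ} (h : Exec p s t s') : Frame p s s' := by
  induction h with
  | skip s => exact .refl _ _
  | setInt s a i e =>
    refine ⟨fun b hb => ?_, fun b _ => rfl, fun hs b k => ?_⟩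
    · have : b ≠ a := by
        rintro rfl
        simp [Prog.writesInt] at hb
      simp [this]
    · by_cases hba : b = a
      · subst hba
        match i, hs with
        | .lit 0, _ => simp [IExpr.eval]
      · simp [hba]
  | setReal s a i e =>
    refine ⟨fun b _ => rfl, fun b hb => ?_, fun _ _ _ => rfl⟩
    have : b ≠ a := by
      rintro rfl
      simp [Prog.writesReal] at hb
    simp [this]
  | seq _ _ h₁ h₂ =>
    refine (h₁.mono ?_ ?_ ?_).trans (h₂.mono ?_ ?_ ?_) <;>
      simp +contextual [Prog.writesInt, Prog.writesReal, Prog.scalarInt]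
  | iteTrue _ _ h =>
    refine h.mono ?_ ?_ ?_ <;>
      simp +contextual [Prog.writesInt, Prog.writesReal, Prog.scalarInt]
  | iteFalse _ _ h =>
    refine h.mono ?_ ?_ ?_ <;>
      simp +contextual [Prog.writesInt, Prog.writesReal, Prog.scalarInt]
  | loopTrue _ _ _ h₁ h₂ => exact (h₁.mono (q := .loop _ _) (fun _ h => h) (fun _ h => h) (fun h => h)).trans h₂
  | loopFalse _ => exact .refl _ _

theorem HaltsWithin.wp {p : Prog} {s : Mem} {T : ℕ} {post : Mem → Prop} {R : ℕ → Mem → Prop}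
    (h : HaltsWithin p s T post)
    (hR : ∀ t s', t ≤ T → Frame p s s' → post s' → R t s') : Wp p s R := by
  obtain ⟨t, s', he, ht, hp⟩ := h
  exact ⟨t, s', he, hR t s' ht he.frame hp⟩

theorem HaltsWithin.frame {p : Prog} {s : Mem} {T : ℕ} {post : Mem → Prop}
    (h : HaltsWithin p s T post) :
    HaltsWithin p s T fun s' => Frame p s s' ∧ post s' := by
  obtain ⟨t, s', he, ht, hp⟩ := h
  exact ⟨t, s', he, ht, he.frame, hp⟩

/-- The invariant carries the iteration number, and `N` bounds the iterations at which the test can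
still succeed. Hence at most `N` bodies and `N + 1` tests are executed. -/
theorem HaltsWithin.loop {b : Test} {p : Prog} {T N : ℕ} {s : Mem} {Inv : ℕ → Mem → Prop}
    (h0 : Inv 0 s) (hN : ∀ k s', Inv k s' → b.Holds s' → k < N)
    (hstep : ∀ k s', Frame (.loop b p) s s' → Inv k s' → b.Holds s' →
      HaltsWithin p s' T (Inv (k + 1))) :
    HaltsWithin (.loop b p) s ((N + 1) * (T + b.cost + 1))
      fun s' => ¬ b.Holds s' ∧ ∃ k, Inv k s' := by
  -- Induction on the number `m` of iterations that may remain, with `N ≤ k + m`.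
  have key : ∀ m k s', Frame (.loop b p) s s' → Inv k s' → N ≤ k + m →
      HaltsWithin (.loop b p) s' ((m + 1) * (T + b.cost + 1))
        fun s' => ¬ b.Holds s' ∧ ∃ k, Inv k s' := by
    intro m
    induction m with
    | zero =>
      intro k s' _ hk hm
      have hb : ¬ b.Holds s' := fun hb => by
        have := hN k s' hk hb
        omega
      exact ⟨_, _, .loopFalse hb, by omega, hb, k, hk⟩
    | succ m ih =>
      intro k s' hF hk hm
      by_cases hb : b.Holds s'
      · obtain ⟨t, s₁, he, ht, hI⟩ := hstep k s' hF hk hb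
        obtain ⟨t', s₂, he', ht', hI'⟩ := ih (k + 1) s₁
          (hF.trans (he.frame.mono (fun _ h => h) (fun _ h => h) (fun h => h))) hI (by omega)
        refine ⟨_, _, .loopTrue hb he he', ?_, hI'⟩
        rw [add_mul (m + 1) 1]
        omega
      · refine ⟨_, _, .loopFalse hb, ?_, hb, k, hk⟩
        calc b.cost + 1 ≤ 1 * (T + b.cost + 1) := by omega
          _ ≤ _ := Nat.mul_le_mul_right _ (by omega)
  exact key N 0 s (.refl _ _) h0 (by omega)

/-- The integer variable stored in cell `0` of integer array `a`. -/
abbrev IExpr.var (a : ℕ) : IExpr := .get a (.lit 0)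

/-- The real variable stored in cell `0` of real array `a`. -/
abbrev RExpr.var (a : ℕ) : RExpr := .get a (.lit 0)

/-- The assignment `a := e` to an integer variable. -/
abbrev Prog.assign (a : ℕ) (e : IExpr) : Prog := .setInt a (.lit 0) e

/-- Repeat `p` with the counter `a` running through the numbers below `e`. -/
def Prog.for (a : ℕ) (e : IExpr) (p : Prog) : Prog :=
  .seq (.assign a (.lit 0))
    (.loop (.neg (.leInt e (.var a))) (.seq p (.assign a (.add (.var a) (.lit 1)))))

/-- The bound `e` is evaluated anew at every test, so its value must be stable along the loop. The
15 covers the remaining cost of the test, the increment, and the initial assignment charged to each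
round. -/
theorem HaltsWithin.for {a : ℕ} {e : IExpr} {p : Prog} {T N : ℕ} {s : Mem}
    (Inv : ℕ → Mem → Prop) (hp : p.writesInt a = false)
    (he : ∀ s', Frame (.for a e p) s s' → e.eval s' = N)
    (h0 : Inv 0 (s.putInt a 0 0))
    (hstep : ∀ k < N, ∀ s', Frame (.for a e p) s s' → s'.int a 0 = k → Inv k s' →
      HaltsWithin p s' T fun s'' => Inv (k + 1) (s''.putInt a 0 (k + 1))) :
    HaltsWithin (.for a e p) s ((N + 1) * (T + e.cost + 15)) (Inv N) := by
  have hF1 : Frame (.for a e p) s (s.putInt a 0 0) := by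
    refine (Exec.setInt s a (.lit 0) (.lit 0)).frame.mono ?_ ?_ ?_ <;>
      simp +contextual [Prog.for, Prog.writesInt, Prog.writesReal, Prog.scalarInt]
  have hl := HaltsWithin.loop (b := .neg (.leInt e (.var a)))
    (p := .seq p (.assign a (.add (.var a) (.lit 1)))) (T := T + 6) (N := N)
    (s := s.putInt a 0 0)
    (Inv := fun k s' => k ≤ N ∧ Frame (.for a e p) s s' ∧ s'.int a 0 = k ∧ Inv k s')
    ⟨by omega, hF1, by simp, h0⟩
    (by
      rintro k s' ⟨_, hF, hk, _⟩ hb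
      simp only [Test.Holds, IExpr.eval, he s' hF, hk] at hb
      omega)
    (by
      rintro k s' - ⟨_, hF, hk, hI⟩ hb
      simp only [Test.Holds, IExpr.eval, he s' hF, hk] at hb
      rw [haltsWithin_iff_wp, wp_seq]
      refine (hstep k (by omega) s' hF hk hI).wp fun t s'' ht hF' hI' => ?_
      rw [wp_setInt]
      have hka : s''.int a 0 = k := by rw [hF'.int a hp, hk]
      simp only [IExpr.eval, IExpr.cost, hka]
      refine ⟨by omega, by omega, ?_, by simp, hI'⟩
      refine (hF.trans (hF'.mono ?_ ?_ ?_)).trans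
        ((Exec.setInt s'' a (.lit 0) (.lit (k + 1))).frame.mono ?_ ?_ ?_) <;>
      simp +contextual [Prog.for, Prog.writesInt, Prog.writesReal, Prog.scalarInt])
  rw [haltsWithin_iff_wp, Prog.for, wp_seq, wp_setInt]
  refine hl.wp ?_
  rintro t s' ht - ⟨hb, k, hkN, hF, hk, hI⟩
  simp only [Test.Holds, IExpr.eval, he s' hF, hk, not_not] at hb
  obtain rfl : k = N := by omega
  refine ⟨?_, hI⟩
  simp only [Test.cost, IExpr.cost] at ht ⊢
  have : (k + 1) * (T + e.cost + 15) = (k + 1) * (T + 6 + (e.cost + (1 + 1) + 1 + 1) + 1)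
      + (k + 1) * 4 := by ring
  omega

end RealRAM

/-! ### The Hungarian algorithm, combinatorially -/

namespace PermSphere.Hungarian

/-- Rows are numbered from `1` to `n`, columns from `0` to `n - 1`.  The potentials `u`, `v`
are feasible for the costs `c`; the rows `1, …, r` are matched to columns along tight edges,
where `p j` is the row matched to the column `j`, and `0` if there is none. -/
structure Matched (n r : ℕ) (c : ℕ → ℕ → ℝ) (u v : ℕ → ℝ) (p : ℕ → ℕ) : Prop where
  feas : ∀ i j, 1 ≤ i → i ≤ n → j < n → u i + v j ≤ c i j
  le : ∀ j < n, p j ≤ r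
  inj : ∀ j < n, ∀ k < n, p j ≠ 0 → p j = p k → j = k
  surj : ∀ i, 1 ≤ i → i ≤ r → ∃ j < n, p j = i
  tight : ∀ j < n, p j ≠ 0 → u (p j) + v j = c (p j) j

/-- The new row `r` is matched to the virtual column `n`, the root of an alternating tree with
columns `U`, parents `w` and ranks `d`; the column `j₀` was added last. -/
structure Tree (n r : ℕ) (c : ℕ → ℕ → ℝ) (u v : ℕ → ℝ) (p w : ℕ → ℕ) (U : Finset ℕ)
    (d : ℕ → ℕ) (j₀ : ℕ) : Prop where
  feas : ∀ i j, 1 ≤ i → i ≤ n → j < n → u i + v j ≤ c i j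
  root : p n = r
  one_le : 1 ≤ r
  r_le : r ≤ n
  lt : ∀ j < n, p j < r
  inj : ∀ j ≤ n, ∀ k ≤ n, p j ≠ 0 → p j = p k → j = k
  surj : ∀ i, 1 ≤ i → i ≤ r → ∃ j ≤ n, p j = i
  tight : ∀ j < n, p j ≠ 0 → u (p j) + v j = c (p j) j
  sub : U ⊆ Finset.range (n + 1)
  cur : j₀ ∈ U
  pos : ∀ j ∈ U, j ≠ j₀ → p j ≠ 0
  edge : ∀ j ∈ U, j ≠ n → w j ∈ U ∧ d (w j) < d j ∧ u (p (w j)) + v j = c (p (w j)) j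
  rank : ∀ j ∈ U, d j < U.card

/-- The rows `1, …, r` are matched to columns different from `j₀`, and moving the match of the
parent of `j₀` to `j₀` is the next step of the augmentation. -/
structure Augmenting (n r : ℕ) (c : ℕ → ℕ → ℝ) (u v : ℕ → ℝ) (p w : ℕ → ℕ) (U : Finset ℕ)
    (d : ℕ → ℕ) (j₀ : ℕ) : Prop where
  feas : ∀ i j, 1 ≤ i → i ≤ n → j < n → u i + v j ≤ c i j
  le : ∀ j ≤ n, p j ≤ r
  inj : ∀ j ≤ n, ∀ k ≤ n, j ≠ j₀ → k ≠ j₀ → p j ≠ 0 → p j = p k → j = k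
  surj : ∀ i, 1 ≤ i → i ≤ r → ∃ j ≤ n, j ≠ j₀ ∧ p j = i
  tight : ∀ j < n, j ≠ j₀ → p j ≠ 0 → u (p j) + v j = c (p j) j
  sub : U ⊆ Finset.range (n + 1)
  cur : j₀ ∈ U
  parent : ∀ j ∈ U, j ≠ n → w j ∈ U ∧ d (w j) < d j
  edge : ∀ j ∈ U, j ≠ n → d j ≤ d j₀ → u (p (w j)) + v j = c (p (w j)) j

variable {n r : ℕ} {c : ℕ → ℕ → ℝ} {u v : ℕ → ℝ} {p w : ℕ → ℕ} {U : Finset ℕ} {d : ℕ → ℕ}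
  {j₀ : ℕ}

theorem matched_zero (hc : ∀ i j, 1 ≤ i → i ≤ n → j < n → 0 ≤ c i j) :
    Matched n 0 c 0 0 0 where
  feas i j h1 h2 h3 := by simpa using hc i j h1 h2 h3
  le _ _ := le_rfl
  inj _ _ _ _ h := by simp at h
  surj i _ _ := by omega
  tight _ _ h := by simp at h

/-- The new row sits on the virtual column `n`, which alone forms the tree. Nothing is required of
an edge into column `n`, so the matching invariants persist. -/
theorem Matched.tree (h : Matched n r c u v p) (hr : r < n) (w : ℕ → ℕ) :
    Tree n (r + 1) c u v (Function.update p n (r + 1)) w {n} 0 n where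
  feas := h.feas
  root := by simp
  one_le := by omega
  r_le := hr
  lt j hj := by
    rw [Function.update_of_ne hj.ne]
    exact Nat.lt_succ_of_le (h.le j hj)
  inj j hj k hk := by
    have hle := h.le
    have hinj := h.inj j
    simp only [Function.update_apply]
    grind
  surj i h1 h2 := by
    rcases Nat.lt_or_ge r i with hi | hi
    · exact ⟨n, le_rfl, by simp; omega⟩
    · obtain ⟨j, hj, rfl⟩ := h.surj i h1 hi
      exact ⟨j, hj.le, by rw [Function.update_of_ne hj.ne]⟩
  tight j hj := by
    rw [Function.update_of_ne hj.ne]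
    exact h.tight j hj
  sub := by simp
  cur := by simp
  pos := by simp
  edge := by simp +contextual
  rank := by simp

/-- If every real column were in the tree, all would be matched, injectively, to the rows `1, …, r -
1`, which are fewer than `n`. -/
theorem Tree.exists_free (h : Tree n r c u v p w U d j₀) (h0 : p j₀ ≠ 0) :
    ∃ j < n, j ∉ U := by
  by_contra! hU
  have hpos : ∀ j < n, p j ≠ 0 := fun j hj => by
    by_cases hj0 : j = j₀
    · rwa [hj0]
    · exact h.pos j (hU j hj) hj0
  have : (Finset.range n).card ≤ (Finset.Ico 1 r).card := by
    refine Finset.card_le_card_of_injOn p (fun j hj => ?_) (fun j hj k hk hjk => ?_)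
    · simp only [Finset.coe_range, Set.mem_Iio, Finset.coe_Ico, Set.mem_Ico] at hj ⊢
      exact ⟨Nat.one_le_iff_ne_zero.2 (hpos j hj), h.lt j hj⟩
    · simp only [Finset.coe_range, Set.mem_Iio] at hj hk
      exact h.inj j hj.le k hk.le (hpos j hj) hjk
  have := h.one_le
  have := h.r_le
  simp only [Finset.card_range, Nat.card_Ico] at *
  omega

theorem Tree.card_le (h : Tree n r c u v p w U d j₀) (h0 : p j₀ ≠ 0) : U.card ≤ n := by
  obtain ⟨j, hj, hjU⟩ := h.exists_free h0
  have : insert j U ⊆ Finset.range (n + 1) :=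
    Finset.insert_subset (Finset.mem_range.2 (by omega)) h.sub
  have := Finset.card_le_card this
  rw [Finset.card_insert_of_notMem hjU, Finset.card_range] at this
  omega

/-- Raising the tree rows and lowering the tree columns by `δ` keeps edges inside the tree tight and
relaxes edges entering it from other rows. Edges leaving it lose `δ` of slack, which is affordable
because `δ` is the least such slack, and the minimising edge becomes tight. The new column gets rank
`U.card`, larger than all earlier ranks. -/
theorem Tree.step (h : Tree n r c u v p w U d j₀) (h0 : p j₀ ≠ 0) {j₁ j₂ : ℕ} {δ : ℝ}
    (h1 : j₁ ∈ U) (h2 : j₂ < n) (h2U : j₂ ∉ U) (hδ : δ = c (p j₁) j₂ - u (p j₁) - v j₂)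
    (hmin : ∀ k ∈ U, ∀ j < n, j ∉ U → δ ≤ c (p k) j - u (p k) - v j) :
    Tree n r c (fun i => if i ∈ U.image p then u i + δ else u i)
      (fun j => if j ∈ U then v j - δ else v j) p (Function.update w j₂ j₁) (insert j₂ U)
      (Function.update d j₂ U.card) j₂ := by
  have hpos : ∀ j ∈ U, p j ≠ 0 := fun j hj => by
    by_cases hj0 : j = j₀
    · rwa [hj0]
    · exact h.pos j hj hj0
  have hlen : ∀ j ∈ U, j ≤ n := fun j hj => by
    have := Finset.mem_range.1 (h.sub hj)
    omega
  have hple : ∀ j ≤ n, p j ≤ n := fun j hj => by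
    have := h.r_le
    rcases hj.lt_or_eq with hj | rfl
    · exact (h.lt j hj).le.trans this
    · rw [h.root]
      exact this
  have hδ0 : 0 ≤ δ := by
    have := h.feas (p j₁) j₂ (Nat.one_le_iff_ne_zero.2 (hpos _ h1)) (hple _ (hlen _ h1)) h2
    linarith
  have hmem : ∀ k ∈ U, p k ∈ U.image p := fun k hk => Finset.mem_image_of_mem p hk
  refine ⟨fun i j hi hin hj => ?_, h.root, h.one_le, h.r_le, h.lt, h.inj, h.surj,
    fun j hj hpj => ?_, ?_, by simp, fun j hj hjne => ?_, fun j hj hjn => ?_, fun j hj => ?_⟩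
  · have hf := h.feas i j hi hin hj
    by_cases hiU : i ∈ U.image p
    · obtain ⟨k, hk, rfl⟩ := Finset.mem_image.1 hiU
      by_cases hjU : j ∈ U
      · simp only [hiU, hjU, if_true]
        linarith
      · have := hmin k hk j hj hjU
        simp only [hiU, hjU, if_true, if_false]
        linarith
    · simp only [hiU, if_false]
      split_ifs <;> linarith
  · have ht := h.tight j hj hpj
    by_cases hjU : j ∈ U
    · simp only [hmem j hjU, hjU, if_true]
      linarith
    -- A matched column outside the tree is matched to a row outside the tree, by injectivity, so
    -- neither potential changes.
    · have : p j ∉ U.image p := by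
        intro hc
        obtain ⟨k, hk, hkj⟩ := Finset.mem_image.1 hc
        exact hjU (h.inj k (hlen k hk) j hj.le (hpos k hk) hkj ▸ hk)
      simp only [this, hjU, if_false]
      exact ht
  · exact Finset.insert_subset (Finset.mem_range.2 (by omega)) h.sub
  · exact hpos j (Finset.mem_of_mem_insert_of_ne hj hjne)
  · rcases Finset.mem_insert.1 hj with rfl | hjU
    · have hne : j₁ ≠ j := fun hc => h2U (hc ▸ h1)
      simp only [Function.update_self, Function.update_of_ne hne, h2U, hmem _ h1, if_true,
        if_false]
      exact ⟨Finset.mem_insert_of_mem h1, h.rank _ h1, by rw [hδ]; ring⟩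
    · have hne : j ≠ j₂ := fun hc => h2U (hc ▸ hjU)
      obtain ⟨hw, hd, he⟩ := h.edge j hjU hjn
      have hwne : w j ≠ j₂ := fun hc => h2U (hc ▸ hw)
      simp only [Function.update_of_ne hne, Function.update_of_ne hwne, hjU, hmem _ hw, if_true]
      exact ⟨Finset.mem_insert_of_mem hw, hd, by linarith⟩
  · rw [Finset.card_insert_of_notMem h2U]
    rcases Finset.mem_insert.1 hj with rfl | hjU
    · simp
    · have hne : j ≠ j₂ := fun hc => h2U (hc ▸ hjU)
      rw [Function.update_of_ne hne]
      exact (h.rank j hjU).trans (Nat.lt_succ_self _)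

theorem Tree.augmenting (h : Tree n r c u v p w U d j₀) (h0 : p j₀ = 0) :
    Augmenting n r c u v p w U d j₀ where
  feas := h.feas
  le j hj := by
    rcases hj.lt_or_eq with hj | rfl
    · exact (h.lt j hj).le
    · exact h.root.le
  inj j hj k hk _ _ := h.inj j hj k hk
  surj i h1 h2 := by
    obtain ⟨j, hj, rfl⟩ := h.surj i h1 h2
    refine ⟨j, hj, ?_, rfl⟩
    rintro rfl
    omega
  tight j hj _ := h.tight j hj
  sub := h.sub
  cur := h.cur
  parent j hj hjn := ⟨(h.edge j hj hjn).1, (h.edge j hj hjn).2.1⟩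
  edge j hj hjn _ := (h.edge j hj hjn).2.2

/-- Overwriting `p j₀` spoils only tree edges whose parent is `j₀`. Those children have larger rank
than `j₀`, whereas tightness is needed only for columns of rank at most that of the current one, and
this rank falls at each step. -/
theorem Augmenting.step (h : Augmenting n r c u v p w U d j₀) (h0 : j₀ ≠ n) :
    Augmenting n r c u v (Function.update p j₀ (p (w j₀))) w U d (w j₀) := by
  obtain ⟨hwU, hdw⟩ := h.parent j₀ h.cur h0
  have hne : w j₀ ≠ j₀ := fun hc => by
    rw [hc] at hdw
    omega
  have hlen : ∀ j ∈ U, j ≤ n := fun j hj => by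
    have := Finset.mem_range.1 (h.sub hj)
    omega
  refine ⟨h.feas, fun j hj => ?_, fun j hj k hk hjw hkw => ?_, fun i h1 h2 => ?_,
    fun j hj hjw => ?_, h.sub, hwU, h.parent, fun j hj hjn hdj => ?_⟩
  · rw [Function.update_apply]
    split_ifs
    · exact h.le _ (hlen _ hwU)
    · exact h.le _ hj
  · have h1 := h.inj j hj k hk
    have h2 := h.inj (w j₀) (hlen _ hwU) k hk hne
    have h3 := h.inj j hj (w j₀) (hlen _ hwU)
    simp only [Function.update_apply]
    grind
  · obtain ⟨j, hj, hj0, hji⟩ := h.surj i h1 h2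
    by_cases hjw : j = w j₀
    · exact ⟨j₀, hlen _ h.cur, hne.symm, by rw [Function.update_self, ← hjw, hji]⟩
    · exact ⟨j, hj, hjw, by rw [Function.update_of_ne hj0, hji]⟩
  · by_cases hj0 : j = j₀
    · subst hj0
      simp only [Function.update_self]
      exact fun _ => h.edge j h.cur h0 le_rfl
    · rw [Function.update_of_ne hj0]
      exact h.tight j hj hj0
  · have hwj : w j ≠ j₀ := fun hc => by
      have := (h.parent j hj hjn).2
      rw [hc] at this
      omega
    rw [Function.update_of_ne hwj]
    exact h.edge j hj hjn (by omega)

theorem Augmenting.matched (h : Augmenting n r c u v p w U d n) : Matched n r c u v p where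
  feas := h.feas
  le j hj := h.le j hj.le
  inj j hj k hk := h.inj j hj.le k hk.le hj.ne hk.ne
  surj i h1 h2 := by
    obtain ⟨j, hj, hjn, rfl⟩ := h.surj i h1 h2
    exact ⟨j, lt_of_le_of_ne hj hjn, rfl⟩
  tight j hj := h.tight j hj hj.ne

/-- A complete matching along tight edges is a permutation of minimum cost. -/
theorem Matched.exists_perm (h : Matched n n c u v p) :
    ∃ σ : Equiv.Perm (Fin n), (∀ i j : Fin n, σ i = j ↔ p j = i + 1) ∧
      ∀ τ : Equiv.Perm (Fin n),
        ∑ i : Fin n, c (i + 1) (σ i) ≤ ∑ i : Fin n, c (i + 1) (τ i) := by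
  have hex : ∀ i : Fin n, ∃ j : Fin n, p j = i + 1 := fun i => by
    obtain ⟨j, hj, hji⟩ := h.surj (i + 1) (by omega) (by omega)
    exact ⟨⟨j, hj⟩, hji⟩
  choose f hf using hex
  have hinj : Function.Injective f := fun i i' hii => by
    have h1 := hf i
    rw [hii, hf i'] at h1
    exact Fin.ext (by omega)
  have hbij := Finite.injective_iff_bijective.1 hinj
  refine ⟨Equiv.ofBijective f hbij, fun i j => ⟨?_, fun hj => ?_⟩, fun τ => ?_⟩
  · rintro rfl
    exact hf i
  · exact Fin.ext (h.inj _ (f i).2 _ j.2 (by rw [hf]; omega) (by rw [hf, hj]))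
  -- Weak duality: the total potential is the same for every permutation, bounds each cost from
  -- below, and is attained along tight edges.
  · have hsum : ∀ τ : Equiv.Perm (Fin n), ∑ i : Fin n, (u (i + 1) + v (τ i)) =
        ∑ i : Fin n, u (i + 1) + ∑ i : Fin n, v i := fun τ => by
      rw [Finset.sum_add_distrib, Equiv.sum_comp τ fun i : Fin n => v i]
    calc ∑ i : Fin n, c (i + 1) (Equiv.ofBijective f hbij i)
        = ∑ i : Fin n, (u (i + 1) + v (Equiv.ofBijective f hbij i)) := by
          refine Finset.sum_congr rfl fun i _ => ?_
          have := h.tight (f i) (f i).2 (by rw [hf]; omega)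
          rw [hf] at this
          exact this.symm
      _ = ∑ i : Fin n, (u (i + 1) + v (τ i)) := by rw [hsum, hsum]
      _ ≤ _ := Finset.sum_le_sum fun i _ => h.feas _ _ (by omega) (by omega) (τ i).2

end PermSphere.Hungarian

/-! ### Padded arrays, permutation matrices and the sphere -/

namespace RealRAM

theorem pad_apply {k : ℕ} (v : Fin k → ℝ) (i : Fin k) : pad v i = v i := by
  simp [pad]

theorem pad_of_lt {k : ℕ} (v : Fin k → ℝ) {i : ℕ} (h : i < k) : pad v i = v ⟨i, h⟩ := by
  simp [pad, h]

theorem pad_of_le {k : ℕ} (v : Fin k → ℝ) {i : ℕ} (h : k ≤ i) : pad v i = 0 := by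
  simp [pad, h]

end RealRAM

namespace PermSphere

open RealRAM

theorem inner_matVec {n : ℕ} (A B : MatVec n) : inner ℝ A B = ∑ i, ∑ j, A (i, j) * B (i, j) := by
  rw [PiLp.inner_apply, Fintype.sum_prod_type]
  simp [mul_comm]

theorem mem_sumZero {n : ℕ} {A : MatVec n} :
    A ∈ sumZero n ↔ (∀ i, ∑ j, A (i, j) = 0) ∧ ∀ j, ∑ i, A (i, j) = 0 := by
  have hr : ∀ i, inner ℝ (rowOnes i) A = ∑ j, A (i, j) := fun i => by
    simp [inner_matVec, rowOnes]
  have hc : ∀ j, inner ℝ (colOnes j) A = ∑ i, A (i, j) := fun j => by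
    simp [inner_matVec, colOnes]
  rw [sumZero, Submodule.mem_orthogonal]
  constructor
  · intro h
    refine ⟨fun i => ?_, fun j => ?_⟩
    · rw [← hr]
      exact h _ (Submodule.subset_span (.inl ⟨i, rfl⟩))
    · rw [← hc]
      exact h _ (Submodule.subset_span (.inr ⟨j, rfl⟩))
  · rintro ⟨h1, h2⟩ B hB
    induction hB using Submodule.span_induction with
    | mem x hx =>
      rcases hx with ⟨i, rfl⟩ | ⟨j, rfl⟩
      · rw [hr, h1]
      · rw [hc, h2]
    | zero => simp
    | add x y _ _ hx hy => rw [inner_add_left, hx, hy, add_zero]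
    | smul a x _ hx => rw [inner_smul_left, hx, mul_zero]

theorem permVec_apply {n : ℕ} (σ : Equiv.Perm (Fin n)) (i j : Fin n) :
    permVec σ (i, j) = if σ i = j then 1 else 0 := by
  simp [permVec, PEquiv.toMatrix_apply, eq_comm]

theorem permVec_sub_center_mem {n : ℕ} (σ : Equiv.Perm (Fin n)) :
    permVec σ - center n ∈ sumZero n := by
  rw [mem_sumZero]
  refine ⟨fun i => ?_, fun j => ?_⟩
  · have : (n : ℝ) ≠ 0 := by
      have := i.pos
      positivity
    simp [permVec_apply, center, this]
  · have : (n : ℝ) ≠ 0 := by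
      have := j.pos
      positivity
    have hj : ∀ i, σ i = j ↔ i = σ.symm j := fun i => by rw [Equiv.eq_symm_apply]
    simp [permVec_apply, center, this, hj]

theorem norm_permVec_sub_center_sq {n : ℕ} (hn : 1 ≤ n) (σ : Equiv.Perm (Fin n)) :
    ‖permVec σ - center n‖ ^ 2 = (n : ℝ) - 1 := by
  have hn0 : (n : ℝ) ≠ 0 := by positivity
  rw [← real_inner_self_eq_norm_sq, inner_matVec]
  have : ∀ i j, (permVec σ - center n : MatVec n) (i, j) * (permVec σ - center n : MatVec n) (i, j)
      = (if σ i = j then (1 - 2 / (n : ℝ)) else 0) + 1 / (n : ℝ) ^ 2 := fun i j => by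
    simp only [PiLp.sub_apply, permVec_apply, center]
    split_ifs <;> field_simp <;> ring
  simp only [this, Finset.sum_add_distrib, Finset.sum_ite_eq, Finset.mem_univ, if_true,
    Finset.sum_const, Finset.card_univ, Fintype.card_fin, nsmul_eq_mul]
  field_simp
  ring

theorem toMat_toPoint {n : ℕ} (Q : Basis n) (σ : Equiv.Perm (Fin n)) :
    toMat Q (toPoint Q σ) = permVec σ := by
  rw [toMat, toPoint, LinearIsometryEquiv.symm_apply_apply,
    Submodule.orthogonalProjectionOnto_mem_subspace_eq_self ⟨_, permVec_sub_center_mem σ⟩]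
  simp

theorem toPoint_mem_sphere {n : ℕ} (hn : 1 ≤ n) (Q : Basis n) (σ : Equiv.Perm (Fin n)) :
    toPoint Q σ ∈ sphere n := by
  rw [sphere, mem_sphere_zero_iff_norm, toPoint, LinearIsometryEquiv.norm_map,
    Submodule.orthogonalProjectionOnto_mem_subspace_eq_self ⟨_, permVec_sub_center_mem σ⟩,
    ← norm_permVec_sub_center_sq hn σ, Real.sqrt_sq (norm_nonneg _)]
  rfl

/-- The centre is orthogonal to the subspace, so its subtraction has no effect on the coordinates
and the program may omit it. -/
theorem toPoint_apply {n : ℕ} (Q : Basis n) (σ : Equiv.Perm (Fin n)) (k : Fin ((n - 1) ^ 2)) :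
    toPoint Q σ k = ∑ i, ∑ j, (Q k : MatVec n) (i, j) * permVec σ (i, j) := by
  have hc : inner ℝ (Q k : MatVec n) (center n) = 0 := by
    rw [inner_matVec]
    refine Finset.sum_eq_zero fun i _ => ?_
    have := (mem_sumZero.1 (Q k).2).1 i
    simp only [center, ← Finset.sum_mul, this, zero_mul]
  rw [toPoint, Submodule.orthogonalProjectionOnto_mem_subspace_eq_self
    ⟨_, permVec_sub_center_mem σ⟩, OrthonormalBasis.repr_apply_apply, Submodule.coe_inner,
    inner_sub_right, hc, sub_zero, inner_matVec]

theorem repr_symm_apply {n : ℕ} (Q : Basis n) (y : Point n) (i j : Fin n) :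
    (Q.repr.symm y : MatVec n) (i, j) = ∑ k, y k * (Q k : MatVec n) (i, j) := by
  rw [← Q.sum_repr_symm]
  simp

/-- Each row of a permutation matrix has a single one, and there the squared difference exceeds `T
(i, j) ^ 2` by exactly the edge weight. -/
theorem norm_sub_permVec_sq {n : ℕ} (T : MatVec n) (σ : Equiv.Perm (Fin n)) :
    ‖T - permVec σ‖ ^ 2 = ‖T‖ ^ 2 + ∑ i, weight T i (σ i) := by
  rw [← real_inner_self_eq_norm_sq, ← real_inner_self_eq_norm_sq, inner_matVec, inner_matVec,
    ← Finset.sum_add_distrib]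
  refine Finset.sum_congr rfl fun i _ => ?_
  have : ∀ j, (T - permVec σ : MatVec n) (i, j) * (T - permVec σ : MatVec n) (i, j)
      = T (i, j) * T (i, j) + if σ i = j then weight T i j else 0 := fun j => by
    simp only [PiLp.sub_apply, permVec_apply, weight]
    split_ifs <;> ring
  simp only [this, Finset.sum_add_distrib, Finset.sum_ite_eq, Finset.mem_univ, if_true]

theorem isNearest_iff {n : ℕ} (T : MatVec n) (σ : Equiv.Perm (Fin n)) :
    IsNearest T σ ↔ IsMinWeightMatching (weight T) σ := by
  refine forall_congr' fun τ => ?_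
  rw [← pow_le_pow_iff_left₀ (norm_nonneg _) (norm_nonneg _) two_ne_zero, norm_sub_permVec_sq,
    norm_sub_permVec_sq, add_le_add_iff_left]

/-- The weight equals `1 - 2 * T (i, j)`, an increasing affine function of the cost, and the
constant term contributes equally to all permutations. -/
theorem isNearest_of_cost {n : ℕ} {T : MatVec n} {σ : Equiv.Perm (Fin n)}
    {c : Fin n → Fin n → ℝ} {a : ℝ} (hc : ∀ i j, c i j = a - T (i, j))
    (h : ∀ τ : Equiv.Perm (Fin n), ∑ i, c i (σ i) ≤ ∑ i, c i (τ i)) : IsNearest T σ := by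
  rw [isNearest_iff]
  intro τ
  have hw : ∀ i j, weight T i j = 2 * c i j + (1 - 2 * a) := fun i j => by
    rw [weight, hc]
    ring
  simp only [hw, Finset.sum_add_distrib, ← Finset.mul_sum]
  linarith [h τ]

theorem rowMajor_apply {n : ℕ} (A : MatVec n) (i j : Fin n) (h : i * n + j < n * n) :
    rowMajor A ⟨i * n + j, h⟩ = A (i, j) := by
  have : (⟨i * n + j, h⟩ : Fin (n * n)) = finProdFinEquiv (i, j) := by
    ext
    simp [finProdFinEquiv, add_comm, mul_comm]
  rw [rowMajor, this, Equiv.symm_apply_apply]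

theorem basisEntries_apply {n : ℕ} (Q : Basis n) (k : Fin ((n - 1) ^ 2)) (m : Fin (n * n))
    (h : k * (n * n) + m < (n - 1) ^ 2 * (n * n)) :
    basisEntries Q ⟨k * (n * n) + m, h⟩ = rowMajor (Q k : MatVec n) m := by
  have : (⟨k * (n * n) + m, h⟩ : Fin ((n - 1) ^ 2 * (n * n))) = finProdFinEquiv (k, m) := by
    ext
    simp [finProdFinEquiv, add_comm, mul_comm]
  rw [basisEntries, this, Equiv.symm_apply_apply]

theorem mul_add_lt {a b k m : ℕ} (hk : k < a) (hm : m < b) : k * b + m < a * b :=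
  calc k * b + m < k * b + b := by omega
    _ = (k + 1) * b := by ring
    _ ≤ a * b := Nat.mul_le_mul_right _ hk

theorem pad_basisEntries {n : ℕ} (Q : Basis n) (k : Fin ((n - 1) ^ 2)) (m : Fin (n * n)) :
    pad (basisEntries Q) (k * (n * n) + m) = rowMajor (Q k : MatVec n) m := by
  rw [pad_of_lt _ (mul_add_lt k.2 m.2), basisEntries_apply]

theorem sum_rowMajor {n : ℕ} (A B : MatVec n) :
    ∑ m, rowMajor A m * rowMajor B m = ∑ i, ∑ j, A (i, j) * B (i, j) := by
  rw [← Fintype.sum_prod_type']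
  exact Equiv.sum_comp finProdFinEquiv.symm fun q : Fin n × Fin n => A q * B q

/-- An entry is at most the Euclidean norm, here `√(n - 1) ≤ n`. This makes the costs `n` minus
entry nonnegative. -/
theorem repr_symm_apply_le {n : ℕ} (hn : 1 ≤ n) (Q : Basis n) {y : Point n} (hy : y ∈ sphere n)
    (q : Fin n × Fin n) : (Q.repr.symm y : MatVec n) q ≤ n := by
  have h1 : ‖(Q.repr.symm y : MatVec n) q‖ ≤ ‖(Q.repr.symm y : MatVec n)‖ :=
    PiLp.norm_apply_le _ q
  rw [← Submodule.coe_norm, LinearIsometryEquiv.norm_map, mem_sphere_zero_iff_norm.1 hy] at h1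
  have hn1 : (1 : ℝ) ≤ n := by exact_mod_cast hn
  have h2 : Real.sqrt ((n : ℝ) - 1) ≤ n := by
    rw [Real.sqrt_le_left (by linarith)]
    nlinarith
  exact (le_abs_self _).trans (h1.trans h2)

end PermSphere

/-! ### The Helmert basis and its tensor square -/

namespace PermSphere

open RealRAM

/-- Entry `i` of the `k`-th vector of the Helmert basis of the vectors with sum zero: `k + 1`
equal entries, followed by one entry that balances them, followed by zeros. -/
noncomputable def helmert (k i : ℕ) : ℝ :=
  (if i ≤ k then 1 else if i = k + 1 then -((k : ℝ) + 1) else 0) /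
    Real.sqrt (((k : ℝ) + 1) * ((k : ℝ) + 2))

theorem sum_helmert_mul {n k : ℕ} (hk : k + 1 < n) (f : ℕ → ℝ) :
    ∑ i ∈ Finset.range n, helmert k i * f i =
      (∑ i ∈ Finset.range (k + 1), f i - (k + 1) * f (k + 1)) /
        Real.sqrt (((k : ℝ) + 1) * ((k : ℝ) + 2)) := by
  have hsub : Finset.range (k + 2) ⊆ Finset.range n := Finset.range_subset_range.2 hk
  rw [← Finset.sum_subset hsub fun i _ hi => ?_]
  · have h1 : ∀ i ∈ Finset.range (k + 1), helmert k i * f i =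
        f i / Real.sqrt (((k : ℝ) + 1) * ((k : ℝ) + 2)) := fun i hi => by
      rw [helmert, if_pos (Nat.lt_succ_iff.1 (Finset.mem_range.1 hi))]
      ring
    rw [Finset.sum_range_succ, Finset.sum_congr rfl h1, ← Finset.sum_div, helmert,
      if_neg (by omega), if_pos rfl]
    ring
  · have : k + 2 ≤ i := by simpa using hi
    rw [helmert, if_neg (by omega), if_neg (by omega)]
    simp

theorem sum_helmert {n k : ℕ} (hk : k + 1 < n) : ∑ i ∈ Finset.range n, helmert k i = 0 := by
  have := sum_helmert_mul hk fun _ => 1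
  simpa using this

theorem sum_helmert_mul_self {n k : ℕ} (hk : k + 1 < n) :
    ∑ i ∈ Finset.range n, helmert k i * helmert k i = 1 := by
  have hpos : (0 : ℝ) < ((k : ℝ) + 1) * ((k : ℝ) + 2) := by positivity
  have hs := Real.sqrt_pos.2 hpos
  have hsq := Real.sq_sqrt hpos.le
  have h1 : ∀ i ∈ Finset.range (k + 1), helmert k i =
      1 / Real.sqrt (((k : ℝ) + 1) * ((k : ℝ) + 2)) := fun i hi => by
    rw [helmert, if_pos (Nat.lt_succ_iff.1 (Finset.mem_range.1 hi))]
  rw [sum_helmert_mul hk, Finset.sum_congr rfl h1, Finset.sum_const, Finset.card_range,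
    nsmul_eq_mul, helmert, if_neg (by omega), if_pos rfl]
  field_simp
  rw [hsq]
  push_cast
  ring

/-- On the support `0, …, k + 1` of the earlier vector the later one is constant, and the earlier
one has sum zero. -/
theorem sum_helmert_mul_of_lt {n k l : ℕ} (hl : l + 1 < n) (hkl : k < l) :
    ∑ i ∈ Finset.range n, helmert k i * helmert l i = 0 := by
  have h1 : ∀ i ∈ Finset.range (k + 1), helmert l i = helmert l (k + 1) := fun i hi => by
    have := Finset.mem_range.1 hi
    rw [helmert, helmert, if_pos (by omega), if_pos (by omega)]
  rw [sum_helmert_mul (by omega), Finset.sum_congr rfl h1, Finset.sum_const, Finset.card_range,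
    nsmul_eq_mul]
  push_cast
  rw [sub_self, zero_div]

theorem sum_helmert_mul_helmert {n k l : ℕ} (hk : k + 1 < n) (hl : l + 1 < n) :
    ∑ i ∈ Finset.range n, helmert k i * helmert l i = if k = l then 1 else 0 := by
  rcases lt_trichotomy k l with h | rfl | h
  · rw [sum_helmert_mul_of_lt hl h, if_neg h.ne]
  · rw [sum_helmert_mul_self hk, if_pos rfl]
  · rw [if_neg h.ne', ← sum_helmert_mul_of_lt hk h]
    exact Finset.sum_congr rfl fun i _ => mul_comm _ _

/-- A vector with sum zero that is orthogonal to the Helmert basis vanishes. -/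
theorem eq_zero_of_sum_helmert {n : ℕ} {f : ℕ → ℝ} (hs : ∑ i ∈ Finset.range n, f i = 0)
    (h : ∀ k, k + 1 < n → ∑ i ∈ Finset.range n, helmert k i * f i = 0) :
    ∀ i < n, f i = 0 := by
  -- Orthogonality to vector `k` says that `f (k + 1)` is the mean of `f 0, …, f k`, so all values
  -- agree by strong induction.
  have hconst : ∀ i < n, f i = f 0 := by
    intro i
    induction i using Nat.strong_induction_on with
    | _ i ih =>
      intro hi
      rcases i with _ | k
      · rfl
      · have hk := h k hi
        have hpos : (0 : ℝ) < ((k : ℝ) + 1) * ((k : ℝ) + 2) := by positivity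
        rw [sum_helmert_mul hi, div_eq_zero_iff, or_iff_left (Real.sqrt_pos.2 hpos).ne',
          Finset.sum_congr rfl fun i hi' =>
            ih i (Finset.mem_range.1 hi') ((Finset.mem_range.1 hi').trans hi),
          Finset.sum_const, Finset.card_range, nsmul_eq_mul] at hk
        push_cast at hk
        have hk1 : (0 : ℝ) < (k : ℝ) + 1 := by positivity
        nlinarith
  intro i hi
  rw [Finset.sum_congr rfl fun i hi => hconst i (Finset.mem_range.1 hi), Finset.sum_const,
    Finset.card_range, nsmul_eq_mul, mul_eq_zero] at hs
  rw [hconst i hi]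
  refine hs.resolve_left ?_
  have : 0 < n := by omega
  positivity

/-- The tensor product of two vectors of the Helmert basis. -/
noncomputable def helmertMat (n k l : ℕ) : MatVec n :=
  WithLp.toLp 2 fun p => helmert k p.1 * helmert l p.2

theorem helmertMat_mem {n k l : ℕ} (hk : k + 1 < n) (hl : l + 1 < n) :
    helmertMat n k l ∈ sumZero n := by
  rw [mem_sumZero]
  simp only [helmertMat, ← Finset.mul_sum, ← Finset.sum_mul]
  rw [Fin.sum_univ_eq_sum_range (helmert k) n, Fin.sum_univ_eq_sum_range (helmert l) n,
    sum_helmert hk, sum_helmert hl]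
  simp

theorem inner_helmertMat {n k l : ℕ} (A : MatVec n) :
    inner ℝ (helmertMat n k l) A =
      ∑ i : Fin n, helmert k i * ∑ j : Fin n, helmert l j * A (i, j) := by
  rw [inner_matVec]
  refine Finset.sum_congr rfl fun i _ => ?_
  rw [Finset.mul_sum]
  refine Finset.sum_congr rfl fun j _ => ?_
  rw [helmertMat]
  ring

theorem inner_helmertMat_helmertMat {n k l k' l' : ℕ} (hk : k + 1 < n) (hl : l + 1 < n)
    (hk' : k' + 1 < n) (hl' : l' + 1 < n) :
    inner ℝ (helmertMat n k l) (helmertMat n k' l') = if k = k' ∧ l = l' then 1 else 0 := by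
  rw [inner_helmertMat]
  have : ∀ i : Fin n, helmert k i * ∑ j : Fin n, helmert l j * helmertMat n k' l' (i, j) =
      helmert k i * helmert k' i * ∑ j : Fin n, helmert l j * helmert l' j := fun i => by
    rw [Finset.mul_sum, Finset.mul_sum]
    refine Finset.sum_congr rfl fun j _ => ?_
    rw [helmertMat]
    ring
  simp only [this, ← Finset.sum_mul]
  rw [Fin.sum_univ_eq_sum_range (fun i => helmert k i * helmert k' i) n,
    Fin.sum_univ_eq_sum_range (fun i => helmert l i * helmert l' i) n,
    sum_helmert_mul_helmert hk hk', sum_helmert_mul_helmert hl hl']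
  split_ifs <;> simp_all

theorem eq_zero_of_fin_sum_helmert {n : ℕ} {f : Fin n → ℝ} (hs : ∑ i, f i = 0)
    (h : ∀ k, k + 1 < n → ∑ i : Fin n, helmert k i * f i = 0) (i : Fin n) : f i = 0 := by
  have := eq_zero_of_sum_helmert (n := n) (f := pad f)
    (by
      rw [← Fin.sum_univ_eq_sum_range]
      simpa only [pad_apply] using hs)
    (fun k hk => by
      rw [← Fin.sum_univ_eq_sum_range (fun i => helmert k i * pad f i)]
      simpa only [pad_apply] using h k hk) i i.2
  rwa [pad_apply] at this

/-- The one-dimensional completeness is used twice. For fixed `l`, the products of the rows of `A`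
with vector `l` form a vector with sum zero, by the column sums, and orthogonal to all Helmert
vectors, so it vanishes. Then each row of `A` vanishes for the same reason. -/
theorem eq_zero_of_inner_helmertMat {n : ℕ} {A : MatVec n} (hA : A ∈ sumZero n)
    (h : ∀ k l, k + 1 < n → l + 1 < n → inner ℝ (helmertMat n k l) A = 0) : A = 0 := by
  obtain ⟨hrow, hcol⟩ := mem_sumZero.1 hA
  have h1 : ∀ l, l + 1 < n → ∀ i : Fin n, ∑ j : Fin n, helmert l j * A (i, j) = 0 := by
    intro l hl
    refine eq_zero_of_fin_sum_helmert ?_ fun k hk => ?_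
    · rw [Finset.sum_comm]
      simp only [← Finset.mul_sum, hcol, mul_zero, Finset.sum_const_zero]
    · rw [← inner_helmertMat]
      exact h k l hk hl
  ext ⟨i, j⟩
  exact eq_zero_of_fin_sum_helmert (f := fun j => A (i, j)) (hrow i) (fun l hl => h1 l hl i) j

theorem succ_div_lt {n : ℕ} (a : Fin ((n - 1) ^ 2)) : a / (n - 1) + 1 < n :=
  Nat.add_lt_of_lt_sub (Nat.div_lt_of_lt_mul (by rw [← pow_two]; exact a.2))

theorem succ_mod_lt {n : ℕ} (a : Fin ((n - 1) ^ 2)) : a % (n - 1) + 1 < n := by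
  have h : 0 < n - 1 := Nat.pos_of_ne_zero fun h => by
    have := a.2
    simp [h] at this
  exact Nat.add_lt_of_lt_sub (Nat.mod_lt _ h)

/-- The tensor products of the vectors of the Helmert basis, as elements of the subspace. -/
noncomputable def helmertVec (n : ℕ) (a : Fin ((n - 1) ^ 2)) : sumZero n :=
  ⟨helmertMat n (a / (n - 1)) (a % (n - 1)), helmertMat_mem (succ_div_lt a) (succ_mod_lt a)⟩

theorem orthonormal_helmertVec (n : ℕ) : Orthonormal ℝ (helmertVec n) := by
  rw [orthonormal_iff_ite]
  intro a b
  rw [Submodule.coe_inner, helmertVec, helmertVec,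
    inner_helmertMat_helmertMat (succ_div_lt a) (succ_mod_lt a) (succ_div_lt b) (succ_mod_lt b)]
  congr 1
  rw [Fin.ext_iff, eq_iff_iff]
  constructor
  · rintro ⟨h1, h2⟩
    rw [← Nat.div_add_mod (a : ℕ) (n - 1), h1, h2, Nat.div_add_mod]
  · intro h
    rw [h]
    exact ⟨rfl, rfl⟩

theorem span_helmertVec_orthogonal (n : ℕ) :
    (Submodule.span ℝ (Set.range (helmertVec n)))ᗮ = ⊥ := by
  rw [Submodule.eq_bot_iff]
  intro A hA
  rw [Submodule.mem_orthogonal] at hA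
  refine Subtype.ext (eq_zero_of_inner_helmertMat A.2 fun k l hk hl => ?_)
  have hlt : k * (n - 1) + l < (n - 1) ^ 2 := by
    rw [pow_two]
    exact mul_add_lt (by omega) (by omega)
  have := hA _ (Submodule.subset_span ⟨⟨k * (n - 1) + l, hlt⟩, rfl⟩)
  rw [Submodule.coe_inner, helmertVec] at this
  have hdiv : (k * (n - 1) + l) / (n - 1) = k := by
    rw [mul_comm, Nat.mul_add_div (by omega), Nat.div_eq_of_lt (by omega), add_zero]
  have hmod : (k * (n - 1) + l) % (n - 1) = l := by
    rw [mul_comm, Nat.mul_add_mod, Nat.mod_eq_of_lt (by omega)]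
  simpa only [hdiv, hmod] using this

/-- The orthonormal basis of tensor products of the vectors of the Helmert basis. -/
noncomputable def helmertBasis (n : ℕ) : Basis n :=
  OrthonormalBasis.mkOfOrthogonalEqBot (orthonormal_helmertVec n) (span_helmertVec_orthogonal n)

theorem helmertBasis_apply {n k l : ℕ} (hl : l < n - 1)
    (h : k * (n - 1) + l < (n - 1) ^ 2) (i j : Fin n) :
    (helmertBasis n ⟨k * (n - 1) + l, h⟩ : MatVec n) (i, j) = helmert k i * helmert l j := by
  have hdiv : (k * (n - 1) + l) / (n - 1) = k := by
    rw [mul_comm, Nat.mul_add_div (by omega), Nat.div_eq_of_lt (by omega), add_zero]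
  have hmod : (k * (n - 1) + l) % (n - 1) = l := by
    rw [mul_comm, Nat.mul_add_mod, Nat.mod_eq_of_lt (by omega)]
  simp only [helmertBasis, OrthonormalBasis.coe_of_orthogonal_eq_bot_mk, helmertVec, hdiv, hmod,
    helmertMat]

end PermSphere

/-! ### Polynomial time bounds and the forward program -/

namespace RealRAM

/-- Monomial form of the loop bound: `N + 1 ≤ 2 * n ^ b`, and the overhead is absorbed using `1 ≤ n
^ d`, so nested loops multiply constants and add exponents. -/
theorem HaltsWithin.for_pow {a : ℕ} {e : IExpr} {p : Prog} {n b d K N : ℕ} {s : Mem}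
    (Inv : ℕ → Mem → Prop) (hn : 1 ≤ n) (hN : N ≤ n ^ b) (hp : p.writesInt a = false)
    (he : ∀ s', Frame (.for a e p) s s' → e.eval s' = N)
    (h0 : Inv 0 (s.putInt a 0 0))
    (hstep : ∀ k < N, ∀ s', Frame (.for a e p) s s' → s'.int a 0 = k → Inv k s' →
      HaltsWithin p s' (K * n ^ d) fun s'' => Inv (k + 1) (s''.putInt a 0 (k + 1))) :
    HaltsWithin (.for a e p) s (2 * (K + e.cost + 15) * n ^ (b + d)) (Inv N) := by
  refine (HaltsWithin.for Inv hp he h0 hstep).mono ?_ fun _ h => h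
  have hb : 1 ≤ n ^ b := Nat.one_le_pow _ _ hn
  have hd : 1 ≤ n ^ d := Nat.one_le_pow _ _ hn
  calc (N + 1) * (K * n ^ d + e.cost + 15)
      ≤ (2 * n ^ b) * (K * n ^ d + e.cost * n ^ d + 15 * n ^ d) := by
        refine Nat.mul_le_mul (by omega) ?_
        have := Nat.mul_le_mul_left e.cost hd
        omega
    _ = _ := by ring

/-- Compute `n * n` in integer variable `1` and `(n - 1) ^ 2` in integer variable `2`. -/
def dims : Prog :=
  .seq (.for 6 (.var 0) (.assign 1 (.add (.var 1) (.var 0))))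
    (.for 6 (.sub (.var 0) (.lit 1)) (.assign 2 (.add (.var 2) (.sub (.var 0) (.lit 1)))))

/-- The machine has no integer multiplication, so both products arise by repeated addition. -/
theorem dims_halts {n : ℕ} (hn : 1 ≤ n) {s : Mem} (h0 : s.int 0 0 = n) (h1 : s.int 1 0 = 0)
    (h2 : s.int 2 0 = 0) :
    HaltsWithin dims s (150 * n) fun s' => s'.int 1 0 = n * n ∧ s'.int 2 0 = (n - 1) ^ 2 := by
  have hA := HaltsWithin.for_pow (a := 6) (e := .var 0)
    (p := .assign 1 (.add (.var 1) (.var 0))) (s := s) (N := n) (K := 7) (d := 0) (b := 1)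
    (fun k s' => s'.int 1 0 = k * n) hn (by simp) (by decide)
    (fun s' hF => by simpa [IExpr.eval, hF.int 0 (by decide)] using h0)
    (by simpa using h1)
    (fun k _ s' hF _ hI => by
      rw [haltsWithin_iff_wp, wp_setInt]
      simp [IExpr.eval, IExpr.cost, hF.int 0 (by decide), h0, hI]
      ring)
  refine (hA.frame.seq (T₂ := 80 * n) ?_).mono ?_ fun _ h => h
  · rintro s₁ ⟨hF₁, hI₁⟩
    have h01 : s₁.int 0 0 = n := by rw [hF₁.int 0 (by decide), h0]
    have h21 : s₁.int 2 0 = 0 := by rw [hF₁.int 2 (by decide), h2]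
    have hB := HaltsWithin.for_pow (a := 6) (e := .sub (.var 0) (.lit 1))
      (p := .assign 2 (.add (.var 2) (.sub (.var 0) (.lit 1)))) (s := s₁) (N := n - 1) (K := 9)
      (n := n) (d := 0) (b := 1)
      (fun k s' => s'.int 2 0 = k * (n - 1)) hn (by simp) (by decide)
      (fun s' hF => by simpa [IExpr.eval, hF.int 0 (by decide)] using congrArg (· - 1) h01)
      (by simpa using h21)
      (fun k _ s' hF _ hI => by
        rw [haltsWithin_iff_wp, wp_setInt]
        simp [IExpr.eval, IExpr.cost, hF.int 0 (by decide), h01, hI]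
        ring)
    refine hB.frame.mono (by simp [IExpr.cost]; omega) ?_
    rintro s₂ ⟨hF₂, hI₂⟩
    refine ⟨?_, by rw [hI₂, pow_two]⟩
    rw [hF₂.int 1 (by decide), hI₁]
  · simp [IExpr.cost]
    omega

/-- Execute `p` for all values below `(n - 1) ^ 2` of variable `4` and all values below `n * n`
of variable `5`; variable `3` counts the executions. -/
def sweep (p : Prog) : Prog :=
  .for 4 (.var 2) (.for 5 (.var 1) (.seq p (.assign 3 (.add (.var 3) (.lit 1)))))

theorem sweep_writesInt {p : Prog} (hp : ∀ a, p.writesInt a = false) {a : ℕ} (h3 : a ≠ 3)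
    (h4 : a ≠ 4) (h5 : a ≠ 5) : (sweep p).writesInt a = false := by
  simp [sweep, Prog.for, Prog.writesInt, hp, h3.symm, h4.symm, h5.symm]

/-- Variable `3` always holds `k * (n * n) + m`, the address of entry `m` of basis vector `k`,
obtained without multiplying. `hcarry` passes from the end of one vector to the start of the next.
-/
theorem sweep_halts {n K : ℕ} (hn : 1 ≤ n) {p : Prog} {s : Mem}
    (Inv : ℕ → ℕ → (ℕ → ℕ → ℝ) → Prop)
    (hp : ∀ a, p.writesInt a = false) (h1 : s.int 1 0 = n * n) (h2 : s.int 2 0 = (n - 1) ^ 2)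
    (h3 : s.int 3 0 = 0) (h0 : Inv 0 0 s.real)
    (hcarry : ∀ k R, Inv k (n * n) R → Inv (k + 1) 0 R)
    (hstep : ∀ k < (n - 1) ^ 2, ∀ m < n * n, ∀ s', Frame (sweep p) s s' →
      s'.int 3 0 = k * (n * n) + m → s'.int 4 0 = k → s'.int 5 0 = m → Inv k m s'.real →
      HaltsWithin p s' K fun s'' => Inv k (m + 1) s''.real) :
    HaltsWithin (sweep p) s ((4 * K + 200) * n ^ 4) fun s' => Inv ((n - 1) ^ 2) 0 s'.real := by
  have hin : Prog.writesInt (.for 5 (.var 1) (.seq p (.assign 3 (.add (.var 3) (.lit 1))))) 4 =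
      false := by
    simp [Prog.for, Prog.writesInt, hp]
  have hin' : Prog.writesInt (.seq p (.assign 3 (.add (.var 3) (.lit 1)))) 5 = false := by
    simp [Prog.writesInt, hp]
  have hsw : ∀ a, a ≠ 3 → a ≠ 4 → a ≠ 5 → ∀ s', Frame (sweep p) s s' → s'.int a = s.int a :=
    fun a h3 h4 h5 s' hF => hF.int a (sweep_writesInt hp h3 h4 h5)
  refine ((HaltsWithin.for_pow (K := 2 * (K + 24)) (n := n) (b := 2) (d := 2)
    (N := (n - 1) ^ 2)
    (fun k s' => s'.int 3 0 = k * (n * n) ∧ Inv k 0 s'.real) hn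
    (Nat.pow_le_pow_left (by omega) 2) hin (fun s' hF => ?_) ?_ fun k hk s₁ hF₁ hk4 hI₁ => ?_).mono
    ?_ fun s' h => h.2)
  · simpa [IExpr.eval, hsw 2 (by decide) (by decide) (by decide) s' hF] using h2
  · simpa [h3] using h0
  · obtain ⟨hp3, hI₁⟩ := hI₁
    have hfor : ∀ s₂, Frame (.for 5 (.var 1) (.seq p (.assign 3 (.add (.var 3) (.lit 1))))) s₁ s₂ →
        Frame (sweep p) s s₂ := fun s₂ hF₂ => by
      refine hF₁.trans (hF₂.mono ?_ ?_ ?_) <;>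
        simp +contextual [Prog.for, Prog.writesInt, Prog.writesReal, Prog.scalarInt]
    refine (HaltsWithin.for_pow (K := K + 6) (n := n) (b := 2) (d := 0)
      (N := n * n)
      (fun m s' => s'.int 3 0 = k * (n * n) + m ∧ Inv k m s'.real) hn
      (by rw [pow_two]) hin' (fun s' hF => ?_) ?_ fun m hm s₂ hF₂ hm5 hI₂ => ?_).mono
      ?_ fun s' h => ?_
    · simpa [IExpr.eval, hsw 1 (by decide) (by decide) (by decide) s' (hfor s' hF)] using h1
    · simpa [hp3] using hI₁
    · obtain ⟨hp3', hI₂⟩ := hI₂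
      have hk4' : s₂.int 4 0 = k := by rw [hF₂.int 4 hin, hk4]
      rw [haltsWithin_iff_wp, wp_seq]
      refine (hstep k hk m hm s₂ (hfor s₂ hF₂) hp3' hk4' hm5 hI₂).wp fun t s₃ ht hF₃ hI₃ => ?_
      rw [wp_setInt]
      have : s₃.int 3 0 = k * (n * n) + m := by rw [hF₃.int 3 (hp 3), hp3']
      simp [IExpr.eval, IExpr.cost, this, hI₃]
      omega
    · simp [IExpr.cost]
      refine Nat.mul_le_mul_right _ ?_
      omega
    · obtain ⟨h3', hI'⟩ := h
      simp only [Mem.putInt_real]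
      refine ⟨?_, hcarry k _ hI'⟩
      rw [Mem.putInt_int_of_ne _ _ _ (by decide), h3']
      ring
  · simp only [IExpr.cost]
    refine Nat.mul_le_mul_right _ ?_
    omega

/-- The coordinates of a matrix in a basis. -/
def fwd : Prog :=
  .seq dims (sweep (.setReal 2 (.var 4)
    (.add (.get 2 (.var 4)) (.mul (.get 0 (.var 3)) (.get 1 (.var 5))))))

end RealRAM

namespace PermSphere

open RealRAM

theorem sum_pad_mul {n : ℕ} (Q : Basis n) (A : MatVec n) (k : Fin ((n - 1) ^ 2)) :
    ∑ m ∈ Finset.range (n * n), pad (basisEntries Q) (k * (n * n) + m) * pad (rowMajor A) m =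
      ∑ i, ∑ j, (Q k : MatVec n) (i, j) * A (i, j) := by
  rw [← sum_rowMajor, ← Fin.sum_univ_eq_sum_range fun m =>
    pad (basisEntries Q) (k * (n * n) + m) * pad (rowMajor A) m]
  simp only [pad_basisEntries, pad_apply]

theorem fwd_computesPoint {n : ℕ} (hn : 1 ≤ n) (Q : Basis n) :
    ComputesPoint fwd (pad (basisEntries Q)) Q (500 * n ^ 4) := by
  intro σ
  set q := pad (basisEntries Q) with hq
  set x := pad (rowMajor (permVec σ)) with hx
  let g : ℕ → ℕ → ℝ := fun a m => ∑ t ∈ Finset.range m, q (a * (n * n) + t) * x t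
  have hd := dims_halts hn (s := load n q x) (by simp [load]) (by simp [load]) (by simp [load])
  refine (hd.frame.seq (T₂ := 300 * n ^ 4) ?_).mono ?_ fun _ h => h
  · rintro s ⟨hF, h1, h2⟩
    have h3 : s.int 3 0 = 0 := by rw [hF.int 3 (by decide)]; simp [load]
    have hr0 : s.real 0 = q := by rw [hF.real 0 (by decide)]; simp [load]
    have hr1 : s.real 1 = x := by rw [hF.real 1 (by decide)]; simp [load]
    have hr2 : s.real 2 = 0 := by rw [hF.real 2 (by decide)]; simp [load]
    -- Coordinates before `k` are complete, coordinate `k` is the partial sum over the first `m`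
    -- entries, and later ones are still zero.
    refine (sweep_halts (K := 20) hn (fun k m R => ∀ a, R 2 a =
      if a < k then g a (n * n) else if a = k then g a m else 0) (fun _ => rfl) h1 h2 h3
      (fun a => by simp [hr2, g]) (fun k R hI a => ?_) ?_).mono
      (Nat.mul_le_mul_right _ (by norm_num)) fun s' hI k => ?_
    · rw [hI]
      split_ifs <;> first | rfl | omega
    · intro k hk m hm s' hF' hp h4 h5 hI
      have hr0' : s'.real 0 = q := by rw [hF'.real 0 (by decide), hr0]
      have hr1' : s'.real 1 = x := by rw [hF'.real 1 (by decide), hr1]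
      rw [haltsWithin_iff_wp, wp_setReal]
      refine ⟨by simp [IExpr.cost, RExpr.cost], fun a => ?_⟩
      simp only [IExpr.eval, RExpr.eval, hp, h4, h5, hr0', hr1', Mem.putReal_real_self]
      by_cases ha : a = k
      · subst ha
        rw [Function.update_self, hI]
        simp [g, Finset.sum_range_succ]
      · rw [Function.update_of_ne ha, hI]
        simp [ha]
    · rw [hI, if_pos k.2, toPoint_apply, ← sum_pad_mul]
  · have : n ≤ n ^ 4 := Nat.le_self_pow (by norm_num) n
    omega

end PermSphere

/-! ### The program that writes the basis -/

namespace RealRAM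

/-- The number `1` if the value of `e` is at most that of `f`, and `0` otherwise. -/
def IExpr.indLe (e f : IExpr) : IExpr :=
  .sub (.lit 1) (.sub (.lit 1) (.sub (.add f (.lit 1)) e))

/-- With truncated subtraction, `f + 1 - e` is positive exactly when `e ≤ f`, and `1 - (1 - x)`
sends zero to zero and positive numbers to one. -/
theorem IExpr.eval_indLe (s : Mem) (e f : IExpr) :
    (IExpr.indLe e f).eval s = if e.eval s ≤ f.eval s then 1 else 0 := by
  simp only [indLe, eval]
  split_ifs <;> omega

/-- Entry `b` of vector `a` of the Helmert basis, for two integer variables. -/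
def RExpr.helmert (a b : ℕ) : RExpr :=
  .div
    (.sub (.ofInt (.indLe (.var b) (.var a)))
      (.mul (.ofInt (.add (.var a) (.lit 1)))
        (.sub (.ofInt (.indLe (.var b) (.add (.var a) (.lit 1))))
          (.ofInt (.indLe (.var b) (.var a))))))
    (.sqrt (.mul (.ofInt (.add (.var a) (.lit 1))) (.ofInt (.add (.var a) (.lit 2)))))

/-- The difference of the two indicators singles out the index `a + 1`, so the numerator needs no
branching. -/
theorem RExpr.eval_helmert (s : Mem) (a b : ℕ) :
    (RExpr.helmert a b).eval s = PermSphere.helmert (s.int a 0) (s.int b 0) := by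
  have h₁ : (IExpr.indLe (.var b) (.var a)).eval s = if s.int b 0 ≤ s.int a 0 then 1 else 0 :=
    IExpr.eval_indLe _ _ _
  have h₂ : (IExpr.indLe (.var b) (.add (.var a) (.lit 1))).eval s =
      if s.int b 0 ≤ s.int a 0 + 1 then 1 else 0 := IExpr.eval_indLe _ _ _
  simp only [helmert, eval, h₁, h₂, IExpr.eval, PermSphere.helmert]
  push_cast
  congr 1
  split_ifs <;> first | omega | simp

/-- For nested loops that write consecutive cells: the invariant depends only on the number of cells
written, and each round adds `w` of them. -/
theorem HaltsWithin.for_add {a : ℕ} {e : IExpr} {p : Prog} {n c w b d K N : ℕ} {s : Mem}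
    (J : ℕ → Mem → Prop) (hJ : ∀ c s' v, J c s' → J c (s'.putInt a 0 v)) (hn : 1 ≤ n)
    (hN : N ≤ n ^ b) (hp : p.writesInt a = false)
    (he : ∀ s', Frame (.for a e p) s s' → e.eval s' = N) (h0 : J c s)
    (hstep : ∀ k < N, ∀ s', Frame (.for a e p) s s' → s'.int a 0 = k → J (c + k * w) s' →
      HaltsWithin p s' (K * n ^ d) (J (c + k * w + w))) :
    HaltsWithin (.for a e p) s (2 * (K + e.cost + 15) * n ^ (b + d)) (J (c + N * w)) := by
  refine HaltsWithin.for_pow (fun k => J (c + k * w)) hn hN hp he ?_ fun k hk s' hF hka hI =>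
    (hstep k hk s' hF hka hI).mono le_rfl fun s'' h => ?_
  · simpa using hJ _ _ _ h0
  · have := hJ _ _ (k + 1) h
    rwa [add_assoc, ← Nat.succ_mul] at this

/-- Write the next entry of the tensor product of two vectors of the Helmert basis. -/
def preStep : Prog :=
  .seq (.setReal 0 (.var 5) (.mul (.helmert 1 3) (.helmert 2 4)))
    (.assign 5 (.add (.var 5) (.lit 1)))

/-- The basis of tensor products of the vectors of the Helmert basis. -/
def pre : Prog :=
  .seq
    (.for 1 (.sub (.var 0) (.lit 1)) (.for 2 (.sub (.var 0) (.lit 1))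
      (.for 3 (.var 0) (.for 4 (.var 0) preStep))))
    (.seq (.assign 1 (.lit 0)) (.seq (.assign 2 (.lit 0)) (.seq (.assign 3 (.lit 0))
      (.seq (.assign 4 (.lit 0)) (.assign 5 (.lit 0))))))

end RealRAM

namespace PermSphere

open RealRAM

theorem pad_helmertBasis {n k l i j : ℕ} (hk : k < n - 1) (hl : l < n - 1) (hi : i < n)
    (hj : j < n) :
    pad (basisEntries (helmertBasis n)) (k * ((n - 1) * (n * n)) + l * (n * n) + i * n + j) =
      helmert k i * helmert l j := by
  have hkl : k * (n - 1) + l < (n - 1) ^ 2 := by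
    rw [pow_two]
    exact mul_add_lt hk hl
  have hij : i * n + j < n * n := mul_add_lt hi hj
  have h := pad_basisEntries (helmertBasis n) ⟨_, hkl⟩ ⟨_, hij⟩
  rw [rowMajor_apply _ ⟨i, hi⟩ ⟨j, hj⟩ hij, helmertBasis_apply hl] at h
  rw [← h]
  congr 1
  ring

/-- The first `c` entries of the basis have been written. -/
def Written (n c : ℕ) (s : Mem) : Prop :=
  s.int 5 0 = c ∧
    s.real 0 = fun t => if t < c then pad (basisEntries (helmertBasis n)) t else 0

theorem Written.putInt {n c a v : ℕ} {s : Mem} (ha : 5 ≠ a) (h : Written n c s) :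
    Written n c (s.putInt a 0 v) := by
  refine ⟨?_, h.2⟩
  rw [Mem.putInt_int_of_ne _ _ _ ha]
  exact h.1

theorem preStep_halts {n k l i j c : ℕ} {s : Mem} (hk : k < n - 1) (hl : l < n - 1) (hi : i < n)
    (hj : j < n) (h1 : s.int 1 0 = k) (h2 : s.int 2 0 = l) (h3 : s.int 3 0 = i)
    (h4 : s.int 4 0 = j) (hc : c = k * ((n - 1) * (n * n)) + l * (n * n) + i * n + j)
    (h : Written n c s) : HaltsWithin preStep s 200 (Written n (c + 1)) := by
  rw [haltsWithin_iff_wp, preStep, wp_seq, wp_setReal, wp_setInt]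
  refine ⟨by simp [IExpr.cost, RExpr.cost, RExpr.helmert, IExpr.indLe], ?_, ?_⟩
  · simp [IExpr.eval, h.1]
  · simp only [RExpr.eval, RExpr.eval_helmert, IExpr.eval, h1, h2, h3, h4, h.1, Mem.putInt_real,
      Mem.putReal_real_self, h.2]
    funext t
    by_cases ht : t = c
    · subst ht
      rw [Function.update_self, if_pos (Nat.lt_succ_self _), hc, pad_helmertBasis hk hl hi hj]
    · rw [Function.update_of_ne ht]
      have : t < c ↔ t < c + 1 := by omega
      simp only [this]

/-- The final memory is determined completely, scratch variables included, so that a second program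
finds exactly its expected input. -/
theorem pre_halts {n : ℕ} (hn : 1 ≤ n) (x : ℕ → ℝ) :
    HaltsWithin pre (load n 0 x) (6000 * n ^ 4)
      fun s => s = load n (pad (basisEntries (helmertBasis n))) x := by
  have hJ : ∀ a, 5 ≠ a → ∀ c s' v, Written n c s' → Written n c (s'.putInt a 0 v) :=
    fun a ha c s' v h => h.putInt ha
  have hload : (load n 0 x).int 0 0 = n := by simp [load]
  have hsub : n - 1 ≤ n ^ 1 := by simp
  have key : HaltsWithin (.for 1 (.sub (.var 0) (.lit 1)) (.for 2 (.sub (.var 0) (.lit 1))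
      (.for 3 (.var 0) (.for 4 (.var 0) preStep)))) (load n 0 x) (5000 * n ^ 4)
      (Written n (0 + (n - 1) * ((n - 1) * (n * n)))) := by
    refine (HaltsWithin.for_add (n := n) (b := 1) (d := 3) (K := 2040) (Written n)
      (hJ 1 (by decide)) hn hsub (by decide)
      (fun s' hF => by simp [IExpr.eval, hF.int 0 (by decide), hload])
      ⟨by simp [load], by simp [load]; rfl⟩ ?_).mono
      (Nat.mul_le_mul_right _ (by simp [IExpr.cost])) fun _ h => h
    intro k hk s₁ hF₁ hk₁ hJ₁
    have hn₁ : s₁.int 0 0 = n := by rw [hF₁.int 0 (by decide), hload]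
    refine (HaltsWithin.for_add (n := n) (b := 1) (d := 2) (w := n * n) (K := 1000) (Written n)
      (hJ 2 (by decide)) hn hsub (by decide)
      (fun s' hF => by simp [IExpr.eval, hF.int 0 (by decide), hn₁]) hJ₁ ?_).mono
      (Nat.mul_le_mul_right _ (by simp [IExpr.cost])) fun _ h => h
    intro l hl s₂ hF₂ hl₂ hJ₂
    have hn₂ : s₂.int 0 0 = n := by rw [hF₂.int 0 (by decide), hn₁]
    have hk₂ : s₂.int 1 0 = k := by rw [hF₂.int 1 (by decide), hk₁]
    refine (HaltsWithin.for_add (n := n) (b := 1) (d := 1) (w := n) (K := 460) (Written n)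
      (hJ 3 (by decide)) hn (by simp) (by decide)
      (fun s' hF => by simp [IExpr.eval, hF.int 0 (by decide), hn₂]) hJ₂ ?_).mono
      (Nat.mul_le_mul_right _ (by simp [IExpr.cost])) fun _ h => h
    intro i hi s₃ hF₃ hi₃ hJ₃
    have hn₃ : s₃.int 0 0 = n := by rw [hF₃.int 0 (by decide), hn₂]
    have hk₃ : s₃.int 1 0 = k := by rw [hF₃.int 1 (by decide), hk₂]
    have hl₃ : s₃.int 2 0 = l := by rw [hF₃.int 2 (by decide), hl₂]
    have := HaltsWithin.for_add (n := n) (b := 1) (d := 0) (w := 1) (K := 200) (N := n)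
      (e := .var 0) (p := preStep) (Written n)
      (hJ 4 (by decide)) hn (by simp) (by decide)
      (fun s' hF => by simp [IExpr.eval, hF.int 0 (by decide), hn₃]) hJ₃
      (fun j hj s₄ hF₄ hj₄ hJ₄ => by
        refine (preStep_halts hk hl hi hj ?_ ?_ ?_ hj₄ ?_ hJ₄).mono (by simp) fun _ h => h
        · rw [hF₄.int 1 (by decide), hk₃]
        · rw [hF₄.int 2 (by decide), hl₃]
        · rw [hF₄.int 3 (by decide), hi₃]
        · ring)
    rw [mul_one] at this
    exact this.mono (Nat.mul_le_mul_right _ (by simp [IExpr.cost])) fun _ h => h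
  have hn4 : 1 ≤ n ^ 4 := Nat.one_le_pow _ _ hn
  rw [haltsWithin_iff_wp, pre, wp_seq]
  refine key.wp fun t s ht hF hW => ?_
  simp only [wp_seq, wp_setInt, IExpr.cost, IExpr.eval]
  refine ⟨by omega, ?_⟩
  refine Mem.ext (funext fun a => funext fun i => ?_) (funext fun a => ?_)
  · have hl : ∀ q, (load n q x).int a i = if a = 0 ∧ i = 0 then n else 0 := fun _ => rfl
    rw [hl]
    rcases i with _ | i
    · by_cases h0 : a = 0
      · subst h0
        simp [hF.int 0 (by decide), hload]
      · by_cases hlt : a < 6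
        · interval_cases a <;> simp_all
        · have hw : Prog.writesInt (.for 1 (.sub (.var 0) (.lit 1))
              (.for 2 (.sub (.var 0) (.lit 1))
                (.for 3 (.var 0) (.for 4 (.var 0) preStep)))) a = false := by
            simp [Prog.for, preStep, Prog.writesInt]
            omega
          have hs : s.int a 0 = 0 := by
            rw [hF.int a hw]
            simp [load, h0]
          rw [Mem.putInt_int_of_ne _ _ _ (by omega), Mem.putInt_int_of_ne _ _ _ (by omega),
            Mem.putInt_int_of_ne _ _ _ (by omega), Mem.putInt_int_of_ne _ _ _ (by omega),
            Mem.putInt_int_of_ne _ _ _ (by omega), hs]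
          simp [h0]
    -- Only variables, cells of index `0`, are assigned, so all other integer cells are still zero.
    · have hs : s.int a (i + 1) = 0 := by
        rw [hF.scalar (by decide)]
        simp [load]
      have hput : ∀ (s : Mem) (b v : ℕ), (s.putInt b 0 v).int a (i + 1) = s.int a (i + 1) :=
        fun s b v => by
          by_cases hab : a = b
          · subst hab
            simp
          · rw [Mem.putInt_int_of_ne _ _ _ hab]
      simp [hput, hs]
  · simp only [Mem.putInt_real]
    by_cases h0 : a = 0
    · subst h0
      rw [hW.2]
      funext t
      simp only [load, if_true]
      split_ifs with ht
      · rfl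
      · rw [pad_of_le]
        have : (n - 1) ^ 2 * (n * n) = 0 + (n - 1) * ((n - 1) * (n * n)) := by ring
        omega
    · have hw : Prog.writesReal (.for 1 (.sub (.var 0) (.lit 1))
          (.for 2 (.sub (.var 0) (.lit 1))
            (.for 3 (.var 0) (.for 4 (.var 0) preStep)))) a = false := by
        simp [Prog.for, preStep, Prog.writesReal]
        omega
      rw [hF.real a hw]
      simp [load, h0]

end PermSphere

/-! ### The Hungarian program and its search for a cheapest leaving edge -/

namespace RealRAM

theorem HaltsWithin.loop_pow {b : Test} {p : Prog} {n d K : ℕ} {s : Mem} (Inv : ℕ → Mem → Prop)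
    (hn : 1 ≤ n) (h0 : Inv 0 s) (hN : ∀ k s', Inv k s' → b.Holds s' → k < n)
    (hstep : ∀ k s', Frame (.loop b p) s s' → Inv k s' → b.Holds s' →
      HaltsWithin p s' (K * n ^ d) (Inv (k + 1))) :
    HaltsWithin (.loop b p) s (2 * (K + b.cost + 1) * n ^ (d + 1))
      fun s' => ¬ b.Holds s' ∧ ∃ k, Inv k s' := by
  refine (HaltsWithin.loop h0 hN hstep).mono ?_ fun _ h => h
  have hd : 1 ≤ n ^ d := Nat.one_le_pow _ _ hn
  calc (n + 1) * (K * n ^ d + b.cost + 1)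
      ≤ (2 * n) * (K * n ^ d + b.cost * n ^ d + 1 * n ^ d) := by
        refine Nat.mul_le_mul (by omega) ?_
        have := Nat.mul_le_mul_left b.cost hd
        omega
    _ = _ := by ring

/-- The column in integer variable `a` belongs to the tree. -/
def Test.inTree (a : ℕ) : Test := .leInt (.var 14) (.get 9 (.var a))

/-- Compare the reduced cost of an edge with the best one found so far. -/
def scanStep : Prog :=
  .ite (.and (.inTree 15) (.neg (.inTree 16)))
    (.seq
      (.setReal 7 (.lit 0)
        (.sub
          (.sub (.get 3 (.add (.get 7 (.get 8 (.var 15))) (.var 16))) (.get 4 (.get 8 (.var 15))))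
          (.get 5 (.var 16))))
      (.ite (.neg (.and (.neg (.leInt (.var 0) (.var 13))) (.leReal (.var 6) (.var 7))))
        (.seq (.setReal 6 (.lit 0) (.var 7))
          (.seq (.assign 12 (.var 15)) (.assign 13 (.var 16))))
        .skip))
    .skip

/-- Find an edge of least reduced cost from the tree to a column outside of it. -/
def scan : Prog :=
  .seq (.assign 13 (.var 0))
    (.for 15 (.add (.var 0) (.lit 1)) (.for 16 (.var 0) scanStep))

/-- Change the potentials of a column of the tree and of the row matched to it. -/
def updateStep : Prog :=
  .ite (.inTree 15)
    (.seq (.setReal 4 (.get 8 (.var 15)) (.add (.get 4 (.get 8 (.var 15))) (.var 6)))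
      (.setReal 5 (.var 15) (.sub (.get 5 (.var 15)) (.var 6))))
    .skip

/-- Change the potentials of all columns of the tree and of the rows matched to them. -/
def update : Prog := .for 15 (.add (.var 0) (.lit 1)) updateStep

/-- Grow the tree until it contains an unmatched column. -/
def grow : Prog :=
  .loop (.neg (.leInt (.get 8 (.var 11)) (.lit 0)))
    (.seq scan (.seq update (.seq (.setInt 9 (.var 13) (.var 14))
      (.seq (.setInt 10 (.var 13) (.var 12)) (.assign 11 (.var 13))))))

/-- Move the matches along the path from the last column of the tree to the root. -/
def augment : Prog :=
  .loop (.neg (.leInt (.var 0) (.var 11)))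
    (.seq (.assign 12 (.get 10 (.var 11)))
      (.seq (.setInt 8 (.var 11) (.get 8 (.var 12))) (.assign 11 (.var 12))))

/-- The Hungarian algorithm: match one row after the other. -/
def hungarian : Prog :=
  .for 17 (.var 0)
    (.seq (.assign 14 (.add (.var 17) (.lit 1)))
      (.seq (.setInt 8 (.var 0) (.var 14))
        (.seq (.setInt 9 (.var 0) (.var 14))
          (.seq (.assign 11 (.var 0)) (.seq grow augment)))))

end RealRAM

namespace PermSphere.Hungarian

open RealRAM

/-- `δ = S j₁ j₂` is the least value of `S` at the pairs in `D` that lead out of `U`, or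
`j₂ = n` if there is no such pair. -/
def Best (n : ℕ) (U : Finset ℕ) (S : ℕ → ℕ → ℝ) (D : ℕ → ℕ → Prop) (j₁ j₂ : ℕ) (δ : ℝ) : Prop :=
  (j₂ = n ∨ j₁ ∈ U ∧ j₂ < n ∧ j₂ ∉ U ∧ δ = S j₁ j₂) ∧
    ∀ k ∈ U, ∀ j < n, j ∉ U → D k j → j₂ ≠ n ∧ δ ≤ S k j

/-- The memory `s` describes row `r`, tree `U` and reduced costs `S`. -/
structure Describes (n r : ℕ) (U : Finset ℕ) (S : ℕ → ℕ → ℝ) (s : Mem) : Prop where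
  size : s.int 0 0 = n
  row : s.int 14 0 = r
  tree : ∀ j ≤ n, j ∈ U ↔ r ≤ s.int 9 j
  slack : ∀ k j,
    S k j = s.real 3 (s.int 7 (s.int 8 k) + j) - s.real 4 (s.int 8 k) - s.real 5 j

theorem Describes.frame {n r : ℕ} {U : Finset ℕ} {S : ℕ → ℕ → ℝ} {s s' : Mem} {p : Prog}
    (h : Describes n r U S s) (hF : Frame p s s')
    (hi : ∀ a ∈ [0, 7, 8, 9, 14], p.writesInt a = false)
    (hr : ∀ a ∈ [3, 4, 5], p.writesReal a = false) : Describes n r U S s' := by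
  have h0 := hF.int 0 (hi 0 (by simp))
  have h7 := hF.int 7 (hi 7 (by simp))
  have h8 := hF.int 8 (hi 8 (by simp))
  have h9 := hF.int 9 (hi 9 (by simp))
  have h14 := hF.int 14 (hi 14 (by simp))
  have h3 := hF.real 3 (hr 3 (by simp))
  have h4 := hF.real 4 (hr 4 (by simp))
  have h5 := hF.real 5 (hr 5 (by simp))
  exact ⟨by rw [h0, h.size], by rw [h14, h.row], by rw [h9]; exact h.tree,
    by rw [h3, h4, h5, h7, h8]; exact h.slack⟩

theorem scanStep_halts {n r k m : ℕ} {U : Finset ℕ} {S : ℕ → ℕ → ℝ} {s : Mem}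
    (h : Describes n r U S s) (hk : k ≤ n) (hm : m < n) (h15 : s.int 15 0 = k)
    (h16 : s.int 16 0 = m)
    (hB : Best n U S (fun k' j' => k' < k ∨ k' = k ∧ j' < m) (s.int 12 0) (s.int 13 0)
      (s.real 6 0)) :
    HaltsWithin scanStep s 100 fun s' =>
      Best n U S (fun k' j' => k' < k ∨ k' = k ∧ j' < m + 1) (s'.int 12 0) (s'.int 13 0)
        (s'.real 6 0) := by
  have hkU := h.tree k hk
  have hmU := h.tree m hm.le
  have hS := h.slack k m
  obtain ⟨hB1, hB2⟩ := hB
  -- The value `n` in variable `13` is a sentinel for "no edge found yet"; it replaces an infinite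
  -- initial minimum.
  have hj2 : n ≤ s.int 13 0 ↔ s.int 13 0 = n := by
    rcases hB1 with h | h <;> omega
  have hD : ∀ k' j', (k' < k ∨ k' = k ∧ j' < m + 1) →
      (k' < k ∨ k' = k ∧ j' < m) ∨ k' = k ∧ j' = m := by omega
  simp only [haltsWithin_iff_wp, scanStep, wp_ite, wp_seq, wp_setReal, wp_setInt, wp_skip,
    Test.inTree, Test.Holds, IExpr.eval, RExpr.eval, h15, h16, h.row, h.size, ← hkU, ← hmU, ← hS,
    Mem.putReal_int, Mem.putReal_real_self, Function.update_self, Test.cost, IExpr.cost,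
    RExpr.cost]
  refine ⟨fun ⟨hk', hm'⟩ => ⟨fun ht => ⟨by omega, ?_⟩, fun ht => ⟨by omega, ?_⟩⟩,
    fun hn' => ⟨by omega, ?_⟩⟩
  · simp only [Mem.putReal_real_of_ne _ _ _ (show 6 ≠ 7 by decide), hj2] at ht
    simp only [Mem.putInt_int_of_ne _ _ _ (show 12 ≠ 13 by decide), Mem.putInt_int_self,
      Mem.putInt_int_of_ne _ _ _ (show 16 ≠ 12 by decide), Mem.putReal_int, h16,
      Mem.putInt_real, Mem.putReal_real_self, Function.update_self]
    refine ⟨.inr ⟨hk', hm, hm', rfl⟩, fun k' hk'' j' hj' hj'' hd => ⟨hm.ne, ?_⟩⟩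
    rcases hD k' j' hd with hd | ⟨rfl, rfl⟩
    · obtain ⟨h1, h2⟩ := hB2 k' hk'' j' hj' hj'' hd
      have : ¬ s.real 6 0 ≤ S k m := fun hle => ht ⟨h1, hle⟩
      linarith
    · exact le_rfl
  · simp only [Mem.putReal_real_of_ne _ _ _ (show 6 ≠ 7 by decide), hj2, not_not] at ht ⊢
    refine ⟨hB1, fun k' hk'' j' hj' hj'' hd => ?_⟩
    rcases hD k' j' hd with hd | ⟨rfl, rfl⟩
    · exact hB2 k' hk'' j' hj' hj'' hd
    · exact ht
  · refine ⟨hB1, fun k' hk'' j' hj' hj'' hd => ?_⟩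
    rcases hD k' j' hd with hd | ⟨rfl, rfl⟩
    · exact hB2 k' hk'' j' hj' hj'' hd
    · exact absurd ⟨hk'', hj''⟩ hn'

theorem scan_halts {n r : ℕ} {U : Finset ℕ} {S : ℕ → ℕ → ℝ} {s : Mem} (hn : 1 ≤ n)
    (h : Describes n r U S s) (hU : U ⊆ Finset.range (n + 1)) {k₀ j₀ : ℕ} (hk₀ : k₀ ∈ U)
    (hj₀ : j₀ < n) (hj₀U : j₀ ∉ U) :
    HaltsWithin scan s (1200 * n ^ 2) fun s' =>
      s'.int 12 0 ∈ U ∧ s'.int 13 0 < n ∧ s'.int 13 0 ∉ U ∧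
        s'.real 6 0 = S (s'.int 12 0) (s'.int 13 0) ∧
        ∀ k ∈ U, ∀ j < n, j ∉ U → s'.real 6 0 ≤ S k j := by
  rw [haltsWithin_iff_wp, scan, wp_seq, wp_setInt]
  set s₀ := s.putInt 13 (IExpr.eval s (.lit 0)) (IExpr.eval s (.var 0)) with hs₀
  have h' : Describes n r U S s₀ :=
    h.frame (Exec.setInt s 13 (.lit 0) (.var 0)).frame (by decide) (by decide)
  -- The outer loop has `n + 1` rounds because the virtual column `n` is scanned too; the bound is
  -- applied with `2 * n` since `n + 1 ≤ 2 * n`.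
  refine (HaltsWithin.for_pow (b := 1) (d := 1) (K := 117) (N := n + 1)
    (e := .add (.var 0) (.lit 1)) (p := .for 16 (.var 0) scanStep) (s := s₀) (n := 2 * n)
    (fun k s' => Best n U S (fun k' _ => k' < k) (s'.int 12 0) (s'.int 13 0) (s'.real 6 0))
    (by omega) (by rw [pow_one]; omega) (by decide)
    (fun s' hF => by
      simp [IExpr.eval, (h'.frame hF (by decide) (by decide)).size])
    ⟨.inl (by simp [hs₀, IExpr.eval, h.size]), fun _ _ _ _ _ h => by omega⟩
    fun k hk s₁ hF₁ hk₁ hB₁ => ?_).wp fun t s' ht _ hB => ?_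
  · have h₁ := h'.frame hF₁ (by decide) (by decide)
    refine (HaltsWithin.for_pow (n := n) (b := 1) (d := 0) (K := 100) (N := n)
      (fun m s' => Best n U S (fun k' j' => k' < k ∨ k' = k ∧ j' < m) (s'.int 12 0)
        (s'.int 13 0) (s'.real 6 0)) hn (by simp) (by decide)
      (fun s' hF => by
        simp [IExpr.eval, (h₁.frame hF (by decide) (by decide)).size])
      (by simpa using hB₁) fun m hm s₂ hF₂ hm₂ hB₂ => ?_).mono ?_ fun s' hB => ?_
    · have hk₂ : s₂.int 15 0 = k := by rw [hF₂.int 15 (by decide), hk₁]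
      refine (scanStep_halts (h₁.frame hF₂ (by decide) (by decide)) (by omega) hm hk₂ hm₂
        hB₂).mono (by simp) fun s' hB => ?_
      simpa using hB
    · simp only [IExpr.cost, add_zero, pow_one]
      omega
    · refine ⟨by simpa using hB.1, fun k' hk' j' hj' hjU hd => ?_⟩
      simpa using hB.2 k' hk' j' hj' hjU (by omega)
  · obtain ⟨hB1, hB2⟩ := hB
    have hlt : ∀ k ∈ U, k < n + 1 := fun k hk => Finset.mem_range.1 (hU hk)
    -- The known pair `k₀`, `j₀` leads out of the tree, so the sentinel cannot have survived.
    obtain ⟨h1, h2, h3, h4⟩ := hB1.resolve_left (hB2 k₀ hk₀ j₀ hj₀ hj₀U (hlt _ hk₀)).1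
    refine ⟨?_, h1, h2, h3, h4, fun k hk j hj hjU => (hB2 k hk j hj hjU (hlt k hk)).2⟩
    have : 1 ≤ n ^ 2 := Nat.one_le_pow _ _ hn
    simp only [IExpr.cost] at ht ⊢
    have e : (2 * n) ^ (1 + 1) = 4 * n ^ 2 := by ring
    rw [e] at ht
    omega

end PermSphere.Hungarian

/-! ### Potential updates, tree growth and augmentation in memory -/

namespace PermSphere.Hungarian

open RealRAM

/-- Rows are reached through their columns, so injectivity on the tree is needed to ensure that no
row potential is raised twice. The cell of the virtual column changes as well, harmlessly. -/
theorem update_halts {n r : ℕ} {U : Finset ℕ} {s : Mem} (hn : 1 ≤ n) (h0 : s.int 0 0 = n)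
    (h14 : s.int 14 0 = r) (hU : ∀ j ≤ n, j ∈ U ↔ r ≤ s.int 9 j)
    (hsub : U ⊆ Finset.range (n + 1))
    (hinj : ∀ j ∈ U, ∀ k ∈ U, s.int 8 j = s.int 8 k → j = k) :
    HaltsWithin update s (300 * n) fun s' =>
      (s'.real 4 = fun i => if i ∈ U.image (s.int 8) then s.real 4 i + s.real 6 0
        else s.real 4 i) ∧
      s'.real 5 = fun j => if j ∈ U then s.real 5 j - s.real 6 0 else s.real 5 j := by
  refine (HaltsWithin.for_pow (n := 2 * n) (b := 1) (d := 0) (K := 40) (N := n + 1)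
    (e := .add (.var 0) (.lit 1)) (p := updateStep) (s := s)
    (fun k s' =>
      (s'.real 4 = fun i => if i ∈ (U.filter (· < k)).image (s.int 8)
        then s.real 4 i + s.real 6 0 else s.real 4 i) ∧
      s'.real 5 = fun j => if j ∈ U.filter (· < k) then s.real 5 j - s.real 6 0
        else s.real 5 j)
    (by omega) (by rw [pow_one]; omega) (by decide)
    (fun s' hF => by simp [IExpr.eval, hF.int 0 (by decide), h0])
    (by simp) fun k hk s₁ hF₁ hk₁ hI₁ => ?_).mono ?_ fun s' hI => ?_
  · obtain ⟨hu, hv⟩ := hI₁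
    have e8 := hF₁.int 8 (by decide)
    have e9 := hF₁.int 9 (by decide)
    have e14 := hF₁.int 14 (by decide)
    have e6 := hF₁.real 6 (by decide)
    have hkU := hU k (by omega)
    simp only [haltsWithin_iff_wp, updateStep, wp_ite, wp_seq, wp_setReal, wp_skip, Test.inTree,
      Test.Holds, IExpr.eval, RExpr.eval, hk₁, e14, e9, h14, ← hkU, e8, e6, Mem.putReal_int,
      Test.cost, IExpr.cost, RExpr.cost, Mem.putReal_real_self, Mem.putInt_real,
      Mem.putReal_real_of_ne _ _ _ (show 4 ≠ 5 by decide),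
      Mem.putReal_real_of_ne _ _ _ (show 5 ≠ 4 by decide),
      Mem.putReal_real_of_ne _ _ _ (show 6 ≠ 4 by decide), pow_zero]
    refine ⟨fun hk' => ⟨by omega, ?_, ?_⟩, fun hk' => ⟨by omega, ?_, ?_⟩⟩
    · have hF : U.filter (· < k + 1) = insert k (U.filter (· < k)) := by
        ext j
        simp only [Finset.mem_filter, Finset.mem_insert, Nat.lt_succ_iff_lt_or_eq]
        constructor
        · tauto
        · rintro (rfl | h)
          · exact ⟨hk', .inr rfl⟩
          · exact ⟨h.1, .inl h.2⟩
      have hni : s.int 8 k ∉ (U.filter (· < k)).image (s.int 8) := by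
        intro hc
        obtain ⟨j, hj, hjk⟩ := Finset.mem_image.1 hc
        obtain ⟨hjU, hjlt⟩ := Finset.mem_filter.1 hj
        exact hjlt.ne (hinj j hjU k hk' hjk)
      rw [hF, Finset.image_insert, hu]
      funext i
      simp only [Function.update_apply, Finset.mem_insert, hni, if_false]
      by_cases hi : i = s.int 8 k
      · simp [hi]
      · simp only [hi, if_false, false_or]
    · have hF : U.filter (· < k + 1) = insert k (U.filter (· < k)) := by
        ext j
        simp only [Finset.mem_filter, Finset.mem_insert, Nat.lt_succ_iff_lt_or_eq]
        constructor
        · tauto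
        · rintro (rfl | h)
          · exact ⟨hk', .inr rfl⟩
          · exact ⟨h.1, .inl h.2⟩
      rw [hF, hv]
      funext j
      simp only [Function.update_apply, Finset.mem_insert]
      by_cases hj : j = k
      · simp [hj]
      · simp [hj]
    all_goals
      have hF : U.filter (· < k + 1) = U.filter (· < k) := by
        ext j
        simp only [Finset.mem_filter, Nat.lt_succ_iff_lt_or_eq]
        constructor
        · rintro ⟨h, h' | rfl⟩
          · exact ⟨h, h'⟩
          · exact absurd h hk'
        · exact fun h => ⟨h.1, .inl h.2⟩
      rw [hF]
      assumption
  · simp only [IExpr.cost]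
    have e : (2 * n) ^ (1 + 0) = 2 * n := by ring
    rw [e]
    omega
  · rwa [Finset.filter_true_of_mem fun j hj => Finset.mem_range.1 (hsub hj)] at hI

/-- The columns that belong to the tree of row `r`. -/
def treeSet (n r : ℕ) (f : ℕ → ℕ) : Finset ℕ := (Finset.range (n + 1)).filter (r ≤ f ·)

theorem mem_treeSet {n r : ℕ} {f : ℕ → ℕ} {j : ℕ} (hj : j ≤ n) :
    j ∈ treeSet n r f ↔ r ≤ f j := by
  simp [treeSet]
  omega

theorem treeSet_update {n r : ℕ} {f : ℕ → ℕ} {j : ℕ} (hj : j ≤ n) :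
    treeSet n r (Function.update f j r) = insert j (treeSet n r f) := by
  ext k
  by_cases hk : k = j
  · subst hk
    simp [treeSet, hj]
  · simp [treeSet, hk]

/-- The memory `s` contains a partial matching and a tree with ranks `d`. -/
structure GrowInv (n r : ℕ) (c : ℕ → ℕ → ℝ) (d : ℕ → ℕ) (s : Mem) : Prop where
  size : s.int 0 0 = n
  row : s.int 14 0 = r
  cost : ∀ i j, s.real 3 (s.int 7 i + j) = c i j
  le : ∀ j, s.int 9 j ≤ r
  tree : Tree n r c (s.real 4) (s.real 5) (s.int 8) (s.int 10) (treeSet n r (s.int 9)) d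
    (s.int 11 0)

theorem GrowInv.step {n r : ℕ} {c : ℕ → ℕ → ℝ} {d : ℕ → ℕ} {s : Mem} (h : GrowInv n r c d s)
    (h0 : s.int 8 (s.int 11 0) ≠ 0) :
    HaltsWithin (.seq scan (.seq update (.seq (.setInt 9 (.var 13) (.var 14))
      (.seq (.setInt 10 (.var 13) (.var 12)) (.assign 11 (.var 13)))))) s (1600 * n ^ 2)
      fun s' => (∃ d', GrowInv n r c d' s') ∧
        (treeSet n r (s'.int 9)).card = (treeSet n r (s.int 9)).card + 1 := by
  have hn : 1 ≤ n := h.tree.one_le.trans h.tree.r_le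
  obtain ⟨j₀, hj₀, hj₀U⟩ := h.tree.exists_free h0
  set U := treeSet n r (s.int 9) with hU
  have hpos : ∀ j ∈ U, s.int 8 j ≠ 0 := fun j hj => by
    by_cases hj0 : j = s.int 11 0
    · rwa [hj0]
    · exact h.tree.pos j hj hj0
  have hlen : ∀ j ∈ U, j ≤ n := fun j hj => by
    have := Finset.mem_range.1 (h.tree.sub hj)
    omega
  have hdesc : Describes n r U
      (fun k j => c (s.int 8 k) j - s.real 4 (s.int 8 k) - s.real 5 j) s :=
    ⟨h.size, h.row, fun j hj => mem_treeSet hj, fun k j => by rw [h.cost]⟩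
  rw [haltsWithin_iff_wp, wp_seq]
  refine (scan_halts hn hdesc h.tree.sub h.tree.cur hj₀ hj₀U).wp
    fun t₁ s₁ ht₁ hF₁ ⟨h12, h13, h13U, hδ, hmin⟩ => ?_
  rw [wp_seq]
  have e0 := hF₁.int 0 (by decide)
  have e7 := hF₁.int 7 (by decide)
  have e8 := hF₁.int 8 (by decide)
  have e9 := hF₁.int 9 (by decide)
  have e10 := hF₁.int 10 (by decide)
  have e14 := hF₁.int 14 (by decide)
  have e3 := hF₁.real 3 (by decide)
  have e4 := hF₁.real 4 (by decide)
  have e5 := hF₁.real 5 (by decide)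
  refine (update_halts (r := r) (U := U) hn (by rw [e0, h.size]) (by rw [e14, h.row])
    (fun j hj => by rw [e9]; exact mem_treeSet hj) h.tree.sub
    (fun j hj k hk hjk => h.tree.inj j (hlen j hj) k (hlen k hk) (hpos j hj)
      (by rwa [e8] at hjk))).wp fun t₂ s₂ ht₂ hF₂ ⟨hu, hv⟩ => ?_
  have f0 := hF₂.int 0 (by decide)
  have f7 := hF₂.int 7 (by decide)
  have f8 := hF₂.int 8 (by decide)
  have f9 := hF₂.int 9 (by decide)
  have f10 := hF₂.int 10 (by decide)
  have f12 := hF₂.int 12 (by decide)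
  have f13 := hF₂.int 13 (by decide)
  have f14 := hF₂.int 14 (by decide)
  have f3 := hF₂.real 3 (by decide)
  have hstep := h.tree.step h0 h12 h13 h13U hδ hmin
  have hset := treeSet_update (r := r) (f := s.int 9) h13.le
  rw [e4, e8] at hu
  rw [e5] at hv
  simp only [wp_seq, wp_setInt, IExpr.eval, IExpr.cost]
  have hle : 1 ≤ n ^ 2 := Nat.one_le_pow _ _ hn
  have hle' : n ≤ n ^ 2 := Nat.le_self_pow (by norm_num) n
  refine ⟨by omega, ⟨Function.update d (s₁.int 13 0) U.card, ?_, ?_, fun i j => ?_, fun j => ?_,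
    ?_⟩, ?_⟩
  · simp [f0, e0, h.size]
  · simp [f14, e14, h.row]
  · simp [f3, e3, f7, e7, h.cost]
  · simp only [ne_eq, Nat.reduceEqDiff, not_false_eq_true,
      Mem.putInt_int_of_ne, Mem.putInt_int_self, f9, e9, f14, e14, h.row, Function.update_apply]
    split_ifs
    · exact le_rfl
    · exact h.le j
  · simpa [hu, hv, f8, e8, f10, e10, f12, f13, f9, e9, f14, e14, h.row, hset] using hstep
  · simp [f9, e9, f13, f14, e14, h.row, hset, Finset.card_insert_of_notMem h13U, ← hU]

/-- Every round enlarges the tree by one column, and while the last column is matched the tree has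
at most `n` columns, so there are at most `n` rounds. -/
theorem grow_halts {n r : ℕ} {c : ℕ → ℕ → ℝ} {d : ℕ → ℕ} {s : Mem} (h : GrowInv n r c d s) :
    HaltsWithin grow s (3300 * n ^ 3) fun s' =>
      s'.int 8 (s'.int 11 0) = 0 ∧ ∃ d', GrowInv n r c d' s' := by
  have hn : 1 ≤ n := h.tree.one_le.trans h.tree.r_le
  refine (HaltsWithin.loop_pow (n := n) (d := 2) (K := 1600)
    (fun m s' => (∃ d', GrowInv n r c d' s') ∧ m < (treeSet n r (s'.int 9)).card) hn
    ⟨⟨d, h⟩, Finset.card_pos.2 ⟨_, h.tree.cur⟩⟩ ?_ ?_).mono ?_ ?_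
  · rintro m s' ⟨⟨d', h'⟩, hm⟩ hb
    have := h'.tree.card_le (by simpa [Test.Holds, IExpr.eval] using hb)
    omega
  · rintro m s' - ⟨⟨d', h'⟩, hm⟩ hb
    refine (h'.step (by simpa [Test.Holds, IExpr.eval] using hb)).mono le_rfl ?_
    rintro s'' ⟨h'', hc⟩
    exact ⟨h'', by omega⟩
  · refine Nat.mul_le_mul_right _ ?_
    simp [Test.cost, IExpr.cost]
  · rintro s' ⟨hb, m, h', -⟩
    exact ⟨by simpa [Test.Holds, IExpr.eval] using hb, h'⟩

/-- The rank of the current column strictly decreases towards the root, so its sum with the number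
of rounds stays at most `n`. -/
theorem augment_halts {n r : ℕ} {c : ℕ → ℕ → ℝ} {u v : ℕ → ℝ} {w : ℕ → ℕ} {U : Finset ℕ}
    {d : ℕ → ℕ} {s : Mem} (hn : 1 ≤ n) (h0 : s.int 0 0 = n) (h10 : s.int 10 = w)
    (h : Augmenting n r c u v (s.int 8) w U d (s.int 11 0)) (hd : d (s.int 11 0) ≤ n) :
    HaltsWithin augment s (100 * n) fun s' => Matched n r c u v (s'.int 8) := by
  refine (HaltsWithin.loop_pow (n := n) (d := 0) (K := 30)
    (fun m s' => s'.int 0 0 = n ∧ s'.int 10 = w ∧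
      Augmenting n r c u v (s'.int 8) w U d (s'.int 11 0) ∧ d (s'.int 11 0) + m ≤ n) hn
    ⟨h0, h10, h, hd⟩ ?_ ?_).mono ?_ ?_
  · rintro m s' ⟨h0, h10, h, hd⟩ hb
    simp only [Test.Holds, IExpr.eval, h0] at hb
    have := (h.parent _ h.cur (by omega)).2
    omega
  · rintro m s' - ⟨h0, h10, h, hd⟩ hb
    simp only [Test.Holds, IExpr.eval, h0] at hb
    have hlt := (h.parent _ h.cur (by omega)).2
    have hstep := h.step (by omega)
    simp only [haltsWithin_iff_wp, wp_seq, wp_setInt, IExpr.eval, IExpr.cost, pow_zero]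
    refine ⟨by omega, ?_, ?_, ?_, ?_⟩
    · simpa using h0
    · simpa using h10
    · simpa [h10] using hstep
    · simp [h10]
      omega
  · simp only [Test.cost, IExpr.cost, zero_add, pow_one]
    exact Nat.mul_le_mul_right _ (by norm_num)
  · rintro s' ⟨hb, m, h0, -, h, -⟩
    simp only [Test.Holds, IExpr.eval, h0, not_not] at hb
    have := Finset.mem_range.1 (h.sub h.cur)
    have he : s'.int 11 0 = n := by omega
    rw [he] at h
    exact h.matched

theorem hungarian_halts {n : ℕ} {c : ℕ → ℕ → ℝ} {s : Mem} (hn : 1 ≤ n) (h0 : s.int 0 0 = n)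
    (hc : ∀ i j, s.real 3 (s.int 7 i + j) = c i j)
    (hpos : ∀ i j, 1 ≤ i → i ≤ n → j < n → 0 ≤ c i j) (h8 : s.int 8 = 0) (h9 : s.int 9 = 0)
    (h4 : s.real 4 = 0) (h5 : s.real 5 = 0) :
    HaltsWithin hungarian s (7200 * n ^ 4) fun s' => ∃ u v, Matched n n c u v (s'.int 8) := by
  refine (HaltsWithin.for_pow (n := n) (b := 1) (d := 3) (K := 3500) (N := n)
    (fun k s' => Matched n k c (s'.real 4) (s'.real 5) (s'.int 8) ∧ ∀ j, s'.int 9 j ≤ k) hn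
    (by simp) (by decide) (fun s' hF => by simp [IExpr.eval, hF.int 0 (by decide), h0]) ?_
    fun k hk s₁ hF₁ hk₁ ⟨hM, h9'⟩ => ?_).mono ?_ fun s' h => ⟨_, _, h.1⟩
  · simp [h4, h5, h8, h9, matched_zero hpos]
  · have e0 : s₁.int 0 0 = n := by rw [hF₁.int 0 (by decide), h0]
    have e7 := hF₁.int 7 (by decide)
    have e3 := hF₁.real 3 (by decide)
    simp only [haltsWithin_iff_wp, wp_seq, wp_setInt, IExpr.eval, IExpr.cost]
    -- Array `9` stores row numbers as stamps. Old stamps are at most `k`, so passing to row `k + 1`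
    -- empties the tree without clearing the array.
    have hset : treeSet n (k + 1) (s₁.int 9) = ∅ := by
      rw [treeSet, Finset.filter_eq_empty_iff]
      intro j _
      have := h9' j
      omega
    refine (grow_halts (n := n) (r := k + 1) (c := c) (d := 0) ⟨?_, ?_, fun i j => ?_,
      fun j => ?_, ?_⟩).wp fun t₂ s₂ ht₂ hF₂ ⟨h2, d, hG⟩ => ?_
    · simpa using e0
    · simp [hk₁]
    · simp [e3, e7, hc]
    · simp only [ne_eq, Nat.reduceEqDiff, not_false_eq_true,
        Mem.putInt_int_of_ne, Mem.putInt_int_self, hk₁, Function.update_apply]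
      have := h9' j
      split_ifs <;> simp
      omega
    · have := hM.tree hk (s₁.int 10)
      simpa [e0, hk₁, treeSet_update, hset] using this
    · refine (augment_halts hn hG.size rfl (hG.tree.augmenting h2) ?_).wp
        fun t₃ s₃ ht₃ hF₃ hM₃ => ⟨?_, ?_, fun j => ?_⟩
      · have := hG.tree.rank _ hG.tree.cur
        have := Finset.card_le_card hG.tree.sub
        rw [Finset.card_range] at this
        omega
      · have hle : 1 ≤ n ^ 3 := Nat.one_le_pow _ _ hn
        have hle' : n ≤ n ^ 3 := Nat.le_self_pow (by norm_num) n
        omega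
      · simpa [hF₃.real 4 (by decide), hF₃.real 5 (by decide)] using hM₃
      · simpa [hF₃.int 9 (by decide)] using hG.le j
  · simp only [IExpr.cost]
    exact Nat.mul_le_mul_right _ (by norm_num)

end PermSphere.Hungarian

/-! ### The backward program -/

namespace RealRAM

/-- Store the offset of row `r`, which is `(r - 1) * n`, in cell `r` of integer array `7`. -/
def offsets : Prog :=
  .for 6 (.var 0)
    (.setInt 7 (.add (.var 6) (.lit 2)) (.add (.get 7 (.add (.var 6) (.lit 1))) (.var 0)))

/-- Set all costs to `n`. -/
def initCosts : Prog := .for 6 (.var 1) (.setReal 3 (.var 6) (.ofInt (.var 0)))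

/-- Subtract the linear combination of the basis with the given coordinates from the costs. -/
def subtractPoint : Prog :=
  sweep (.setReal 3 (.var 5)
    (.sub (.get 3 (.var 5)) (.mul (.get 1 (.var 4)) (.get 0 (.var 3)))))

/-- Write the ones of the permutation matrix to the output array. -/
def emit : Prog :=
  .for 6 (.var 0)
    (.setReal 2 (.add (.get 7 (.get 8 (.var 6))) (.var 6)) (.ofInt (.lit 1)))

/-- The permutation matrix closest to the matrix with given coordinates. -/
def bwd : Prog :=
  .seq dims (.seq offsets (.seq initCosts (.seq subtractPoint (.seq hungarian emit))))

theorem offsets_halts {n : ℕ} (hn : 1 ≤ n) {s : Mem} (h0 : s.int 0 0 = n) (h7 : s.int 7 = 0) :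
    HaltsWithin offsets s (100 * n) fun s' => ∀ i < n, s'.int 7 (i + 1) = i * n := by
  refine (HaltsWithin.for_pow (n := n) (b := 1) (d := 0) (K := 15) (N := n)
    (fun k s' => ∀ i ≤ k, s'.int 7 (i + 1) = i * n) hn (by simp) (by decide)
    (fun s' hF => by simp [IExpr.eval, hF.int 0 (by decide), h0])
    -- The offset of row `1` is already correct because memory starts at zero; round `k` fills the
    -- cell of row `k + 2`.
    (fun i hi => by simp [h7]; omega) fun k hk s₁ hF₁ hk₁ hI₁ => ?_).mono ?_
    fun s' h i hi => h i hi.le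
  · have e0 : s₁.int 0 0 = n := by rw [hF₁.int 0 (by decide), h0]
    simp only [haltsWithin_iff_wp, wp_setInt, IExpr.eval, IExpr.cost, hk₁, e0, hI₁ k le_rfl,
      pow_zero]
    refine ⟨by omega, fun i hi => ?_⟩
    rw [Mem.putInt_int_of_ne _ _ _ (by decide), Mem.putInt_int_self, Function.update_apply]
    split_ifs with h
    · obtain rfl : i = k + 1 := by omega
      ring
    · exact hI₁ i (by omega)
  · simp only [IExpr.cost, add_zero, pow_one]
    exact Nat.mul_le_mul_right _ (by norm_num)

theorem initCosts_halts {n : ℕ} (hn : 1 ≤ n) {s : Mem} (h0 : s.int 0 0 = n)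
    (h1 : s.int 1 0 = n * n) :
    HaltsWithin initCosts s (100 * n ^ 2) fun s' => ∀ t < n * n, s'.real 3 t = n := by
  refine (HaltsWithin.for_pow (n := n) (b := 2) (d := 0) (K := 15) (N := n * n)
    (fun k s' => ∀ t < k, s'.real 3 t = n) hn (by rw [pow_two]) (by decide)
    (fun s' hF => by simp [IExpr.eval, hF.int 1 (by decide), h1])
    (fun i hi => by omega) fun k hk s₁ hF₁ hk₁ hI₁ => ?_).mono ?_ fun s' h => h
  · have e0 : s₁.int 0 0 = n := by rw [hF₁.int 0 (by decide), h0]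
    simp only [haltsWithin_iff_wp, wp_setReal, IExpr.eval, RExpr.eval, IExpr.cost, RExpr.cost,
      hk₁, e0, pow_zero]
    refine ⟨by omega, fun i hi => ?_⟩
    rw [Mem.putInt_real, Mem.putReal_real_self, Function.update_apply]
    split_ifs with h
    · rfl
    · exact hI₁ i (by omega)
  · simp only [IExpr.cost, add_zero]
    exact Nat.mul_le_mul_right _ (by norm_num)

theorem subtractPoint_halts {n : ℕ} (hn : 1 ≤ n) {s : Mem} (h1 : s.int 1 0 = n * n)
    (h2 : s.int 2 0 = (n - 1) ^ 2) (h3 : s.int 3 0 = 0)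
    (hr : ∀ t < n * n, s.real 3 t = n) :
    HaltsWithin subtractPoint s (300 * n ^ 4) fun s' => ∀ t < n * n, s'.real 3 t =
      n - ∑ a ∈ Finset.range ((n - 1) ^ 2), s.real 1 a * s.real 0 (a * (n * n) + t) := by
  -- In the middle of vector `k`, the entries before `m` have received `k + 1` terms and the others
  -- `k`.
  refine (sweep_halts (K := 20) hn (fun k m R => ∀ t < n * n, R 3 t =
      n - ∑ a ∈ Finset.range (if t < m then k + 1 else k),
        s.real 1 a * s.real 0 (a * (n * n) + t)) (fun _ => rfl) h1 h2 h3
      (fun t ht => by simp [hr t ht]) (fun k R hI t ht => ?_) ?_).mono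
      (Nat.mul_le_mul_right _ (by norm_num)) fun s' hI t ht => ?_
  · rw [hI t ht]
    simp [ht]
  · intro k hk m hm s' hF' hp h4 h5 hI
    have hr0 : s'.real 0 = s.real 0 := hF'.real 0 (by decide)
    have hr1 : s'.real 1 = s.real 1 := hF'.real 1 (by decide)
    rw [haltsWithin_iff_wp, wp_setReal]
    refine ⟨by simp [IExpr.cost, RExpr.cost], fun t ht => ?_⟩
    simp only [IExpr.eval, RExpr.eval, hp, h4, h5, hr0, hr1, Mem.putReal_real_self]
    by_cases hc : t = m
    · subst hc
      rw [Function.update_self, hI t ht]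
      simp [Finset.sum_range_succ]
      ring
    · rw [Function.update_of_ne hc, hI t ht]
      have : t < m ↔ t < m + 1 := by omega
      simp only [this]
  · rw [hI t ht]
    simp

theorem emit_halts {n : ℕ} (hn : 1 ≤ n) {s : Mem} (h0 : s.int 0 0 = n) (h2 : s.real 2 = 0) :
    HaltsWithin emit s (100 * n) fun s' => ∀ t, s'.real 2 t =
      open Classical in if ∃ j < n, s.int 7 (s.int 8 j) + j = t then 1 else 0 := by
  classical
  refine (HaltsWithin.for_pow (n := n) (b := 1) (d := 0) (K := 15) (N := n)
    (fun k s' => ∀ t, s'.real 2 t =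
      if ∃ j < k, s.int 7 (s.int 8 j) + j = t then 1 else 0) hn (by simp) (by decide)
    (fun s' hF => by simp [IExpr.eval, hF.int 0 (by decide), h0])
    (fun i => by simp [h2]) fun k hk s₁ hF₁ hk₁ hI₁ => ?_).mono ?_ fun s' h => h
  · have e7 := hF₁.int 7 (by decide)
    have e8 := hF₁.int 8 (by decide)
    simp only [haltsWithin_iff_wp, wp_setReal, IExpr.eval, RExpr.eval, IExpr.cost, RExpr.cost,
      hk₁, e7, e8, pow_zero]
    refine ⟨by omega, fun t => ?_⟩
    rw [Mem.putInt_real, Mem.putReal_real_self, Function.update_apply]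
    split_ifs with h h' h'
    · simp
    · exact absurd ⟨k, by omega, h.symm⟩ h'
    · rw [hI₁, if_pos]
      obtain ⟨j, hj, hjt⟩ := h'
      refine ⟨j, ?_, hjt⟩
      rcases Nat.lt_succ_iff_lt_or_eq.1 hj with hj | rfl
      · exact hj
      · exact absurd hjt.symm h
    · rw [hI₁, if_neg]
      rintro ⟨j, hj, hjt⟩
      exact h' ⟨j, by omega, hjt⟩
  · simp only [IExpr.cost, add_zero, pow_one]
    exact Nat.mul_le_mul_right _ (by norm_num)

end RealRAM

namespace PermSphere

open RealRAM

theorem sum_pad_basisEntries {n : ℕ} (Q : Basis n) (y : Point n) (i j : Fin n) :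
    ∑ a ∈ Finset.range ((n - 1) ^ 2),
      pad y a * pad (basisEntries Q) (a * (n * n) + (i * n + j)) =
        (Q.repr.symm y : MatVec n) (i, j) := by
  have hij : (i : ℕ) * n + j < n * n := mul_add_lt i.2 j.2
  rw [repr_symm_apply, ← Fin.sum_univ_eq_sum_range fun a =>
    pad y a * pad (basisEntries Q) (a * (n * n) + (i * n + j))]
  refine Finset.sum_congr rfl fun a _ => ?_
  rw [pad_apply, pad_basisEntries Q a ⟨_, hij⟩, rowMajor_apply]

theorem bwd_computesPerm {n : ℕ} (hn : 1 ≤ n) (Q : Basis n) :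
    ComputesPerm bwd (pad (basisEntries Q)) Q (8000 * n ^ 4) := by
  intro y hy
  -- The permutation is known only from the final memory, so it is first placed inside the
  -- postcondition.
  suffices h : HaltsWithin bwd (load n (pad (basisEntries Q)) (pad y)) (8000 * n ^ 4) fun s' =>
      ∃ σ : Equiv.Perm (Fin n), IsNearest (toMat Q y) σ ∧ Outputs (rowMajor (permVec σ)) s' by
    obtain ⟨t, s', he, ht, σ, hσ, ho⟩ := h
    exact ⟨σ, hσ, t, s', he, ht, ho⟩
  set s := load n (pad (basisEntries Q)) (pad y) with hs
  have hint : ∀ a, a ≠ 0 → s.int a = 0 := fun a ha => by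
    funext i
    simp [hs, load, ha]
  have hreal : ∀ a, a ≠ 0 → a ≠ 1 → s.real a = 0 := fun a h0 h1 => by
    simp [hs, load, h0, h1]
  have h0 : s.int 0 0 = n := by simp [hs, load]
  rw [haltsWithin_iff_wp, bwd, wp_seq]
  refine (dims_halts hn h0 (by simp [hint]) (by simp [hint])).wp
    fun t₁ s₁ ht₁ hF₁ ⟨h1, h2⟩ => ?_
  rw [wp_seq]
  have h01 : s₁.int 0 0 = n := by rw [hF₁.int 0 (by decide), h0]
  refine (offsets_halts hn h01 (by rw [hF₁.int 7 (by decide), hint 7 (by decide)])).wp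
    fun t₂ s₂ ht₂ hF₂ ho => ?_
  rw [wp_seq]
  have h02 : s₂.int 0 0 = n := by rw [hF₂.int 0 (by decide), h01]
  refine (initCosts_halts hn h02 (by rw [hF₂.int 1 (by decide), h1])).wp
    fun t₃ s₃ ht₃ hF₃ hC => ?_
  rw [wp_seq]
  have h03 : s₃.int 0 0 = n := by rw [hF₃.int 0 (by decide), h02]
  have hq : s₃.real 0 = pad (basisEntries Q) := by
    rw [hF₃.real 0 (by decide), hF₂.real 0 (by decide), hF₁.real 0 (by decide)]
    simp [hs, load]
  have hy3 : s₃.real 1 = pad y := by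
    rw [hF₃.real 1 (by decide), hF₂.real 1 (by decide), hF₁.real 1 (by decide)]
    simp [hs, load]
  refine (subtractPoint_halts hn
    (by rw [hF₃.int 1 (by decide), hF₂.int 1 (by decide), h1])
    (by rw [hF₃.int 2 (by decide), hF₂.int 2 (by decide), h2])
    (by rw [hF₃.int 3 (by decide), hF₂.int 3 (by decide), hF₁.int 3 (by decide)]; simp [hint])
    hC).wp fun t₄ s₄ ht₄ hF₄ hC' => ?_
  rw [wp_seq]
  have h04 : s₄.int 0 0 = n := by rw [hF₄.int 0 (by decide), h03]
  have ho4 : ∀ i < n, s₄.int 7 (i + 1) = i * n := by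
    rw [hF₄.int 7 (by decide), hF₃.int 7 (by decide)]
    exact ho
  have hcost : ∀ i j : Fin n, s₄.real 3 (s₄.int 7 (i + 1) + j) =
      n - (Q.repr.symm y : MatVec n) (i, j) := fun i j => by
    rw [ho4 i i.2, hC' _ (mul_add_lt i.2 j.2), hq, hy3, sum_pad_basisEntries]
  refine (Hungarian.hungarian_halts hn h04 (c := fun i j => s₄.real 3 (s₄.int 7 i + j))
    (fun _ _ => rfl) (fun i j hi hin hj => ?_) ?_ ?_ ?_ ?_).wp
    fun t₅ s₅ ht₅ hF₅ ⟨u, v, hM⟩ => ?_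
  · obtain ⟨i, rfl⟩ : ∃ i', i = i' + 1 := ⟨i - 1, by omega⟩
    have := repr_symm_apply_le hn Q hy (⟨i, hin⟩, ⟨j, hj⟩)
    rw [hcost ⟨i, hin⟩ ⟨j, hj⟩]
    linarith
  · rw [hF₄.int 8 (by decide), hF₃.int 8 (by decide), hF₂.int 8 (by decide),
      hF₁.int 8 (by decide), hint 8 (by decide)]
  · rw [hF₄.int 9 (by decide), hF₃.int 9 (by decide), hF₂.int 9 (by decide),
      hF₁.int 9 (by decide), hint 9 (by decide)]
  · rw [hF₄.real 4 (by decide), hF₃.real 4 (by decide), hF₂.real 4 (by decide),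
      hF₁.real 4 (by decide), hreal 4 (by decide) (by decide)]
  · rw [hF₄.real 5 (by decide), hF₃.real 5 (by decide), hF₂.real 5 (by decide),
      hF₁.real 5 (by decide), hreal 5 (by decide) (by decide)]
  · have h05 : s₅.int 0 0 = n := by rw [hF₅.int 0 (by decide), h04]
    refine (emit_halts hn h05 ?_).wp fun t₆ s₆ ht₆ hF₆ hO => ⟨?_, ?_⟩
    · rw [hF₅.real 2 (by decide), hF₄.real 2 (by decide), hF₃.real 2 (by decide),
        hF₂.real 2 (by decide), hF₁.real 2 (by decide), hreal 2 (by decide) (by decide)]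
    · have : n ^ 2 ≤ n ^ 4 := Nat.pow_le_pow_right hn (by norm_num)
      have : n ≤ n ^ 2 := Nat.le_self_pow (by norm_num) n
      omega
    · obtain ⟨σ, hσ, hmin⟩ := hM.exists_perm
      -- The program never adds the centre: its costs are `n` minus the entries of the vector in the
      -- subspace, hence `n + 1 / n` minus those of `toMat Q y`.
      refine ⟨σ, isNearest_of_cost (a := n + 1 / n)
        (c := fun i j => s₄.real 3 (s₄.int 7 (i + 1) + j)) (fun i j => ?_) hmin, fun t => ?_⟩
      · rw [hcost, toMat, center]
        simp
      · obtain ⟨⟨i, j⟩, rfl⟩ := finProdFinEquiv.surjective t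
        have hval : ((finProdFinEquiv (i, j) : Fin (n * n)) : ℕ) = i * n + j := by
          simp [finProdFinEquiv, add_comm, mul_comm]
        have hiff : (∃ j' < n, s₅.int 7 (s₅.int 8 j') + j' = i * n + j) ↔ σ i = j := by
          rw [hF₅.int 7 (by decide)]
          constructor
          · rintro ⟨j', hj', he⟩
            obtain ⟨i', hi'⟩ := σ.surjective ⟨j', hj'⟩
            have hp := (hσ i' ⟨j', hj'⟩).1 hi'
            rw [hp, ho4 i' i'.2] at he
            have he' : finProdFinEquiv (i', (⟨j', hj'⟩ : Fin n)) = finProdFinEquiv (i, j) := by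
              ext
              rw [hval, ← he]
              simp [finProdFinEquiv, add_comm, mul_comm]
            obtain ⟨rfl, rfl⟩ := Prod.ext_iff.1 (finProdFinEquiv.injective he')
            exact hi'
          · intro h
            refine ⟨j, j.2, ?_⟩
            rw [(hσ i j).1 h, ho4 i i.2]
        rw [hO, hval, rowMajor, Equiv.symm_apply_apply, permVec_apply]
        simp only [hiff]

end PermSphere

/-! ### Assembly -/

theorem mainTheorem3 :
    ∃ (pre fwd bwd : RealRAM.Prog) (C : ℕ), ∀ n : ℕ, 1 ≤ n →
      (∃ Q : PermSphere.Basis n,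
        (∀ x : ℕ → ℝ, RealRAM.HaltsWithin pre (RealRAM.load n 0 x) (C * n ^ 6)
          (fun s => s = RealRAM.load n (RealRAM.pad (PermSphere.basisEntries Q)) x)) ∧
        PermSphere.ComputesPoint (pre.seq fwd) 0 Q (C * n ^ 6) ∧
        PermSphere.ComputesPerm (pre.seq bwd) 0 Q (C * n ^ 6)) ∧
      (∀ Q : PermSphere.Basis n,
        (∀ σ : Equiv.Perm (Fin n),
          PermSphere.toPoint Q σ ∈ PermSphere.sphere n ∧
          PermSphere.toMat Q (PermSphere.toPoint Q σ) = PermSphere.permVec σ) ∧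
        PermSphere.ComputesPoint fwd (RealRAM.pad (PermSphere.basisEntries Q)) Q (C * n ^ 4) ∧
        PermSphere.ComputesPerm bwd (RealRAM.pad (PermSphere.basisEntries Q)) Q (C * n ^ 4)) ∧
      (∀ (T : PermSphere.MatVec n) (σ : Equiv.Perm (Fin n)),
        PermSphere.IsNearest T σ ↔
          PermSphere.IsMinWeightMatching (PermSphere.weight T) σ) := by
  -- The largest total is `6000 + 8000`, for the basis followed by the backward program; `20000`
  -- leaves room.
  refine ⟨RealRAM.pre, RealRAM.fwd, RealRAM.bwd, 20000, fun n hn => ?_⟩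
  have h46 : n ^ 4 ≤ n ^ 6 := Nat.pow_le_pow_right hn (by norm_num)
  refine ⟨⟨PermSphere.helmertBasis n, fun x => ?_, fun σ => ?_, fun y hy => ?_⟩,
    fun Q => ⟨fun σ => ⟨PermSphere.toPoint_mem_sphere hn Q σ, PermSphere.toMat_toPoint Q σ⟩,
      fun σ => ?_, fun y hy => ?_⟩, PermSphere.isNearest_iff⟩
  · exact (PermSphere.pre_halts hn x).mono (by omega) fun _ h => h
  · refine ((PermSphere.pre_halts hn _).seq (T₂ := 500 * n ^ 4) ?_).mono (by omega) fun _ h => h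
    rintro s rfl
    exact PermSphere.fwd_computesPoint hn _ σ
  · obtain ⟨σ, hσ, h⟩ := PermSphere.bwd_computesPerm hn (PermSphere.helmertBasis n) y hy
    refine ⟨σ, hσ, ((PermSphere.pre_halts hn _).seq (T₂ := 8000 * n ^ 4) ?_).mono (by omega)
      fun _ h => h⟩
    rintro s rfl
    exact h
  · exact (PermSphere.fwd_computesPoint hn Q σ).mono (by omega) fun _ h => h
  · obtain ⟨σ, hσ, h⟩ := PermSphere.bwd_computesPerm hn Q y hy
    exact ⟨σ, hσ, h.mono (by omega) fun _ h => h⟩
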